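/- **Setting.** Let $\mathcal S,\mathcal A,\Theta$ be measurable spaces, $r:\mathcal S\times\mathcal A\to\mathbb R$ a measurable reward, $m$ a $\sigma$-finite measure on $\mathcal S$ and, for $\theta\in\Theta$, let $p_\theta(s'\mid s,a)$ be a transition density with respect to $m$, jointly measurable in $(\theta,s,a,s')$. Put $H_t=(S_0,A_0,R_0,\dots,S_{t-1},A_{t-1},R_{t-1},S_t)$ with $R_t=r(S_t,A_t)$, and $\widetilde H_t=(H_t,A_t,R_t)$. A policy $\pi=(\pi_t)_{t\ge 0}$ consists of Markov kernels $\pi_t$ from the values of $H_t$ to $\mathcal A$. Let $P_{\theta,\pi}$ be the law of the process with $S_0\sim\iota$, $A_t\sim\pi_t(H_t)$ and $S_{t+1}\sim p_\theta(\cdot\mid S_t,A_t)\,dm$; let $p^{(t)}_{\theta,\pi}$ denote the density of $H_t$, and $P^{\widetilde H_i,j}_{\theta,\pi}$ the conditional law of $(S_{i+j},A_{i+j})$ given $\widetilde H_i$, with density $p^{\widetilde H_i,j}_{\theta,\pi}$ with respect to a finite measure $\lambda$ on $\mathcal S\times\mathcal A$ (inequalities between such densities are understood as inequalities between the corresponding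 measures). For measurable $\mu:\mathcal S\times\mathcal A\to[0,\infty)$ put $$d_\mu^2(\theta,\theta')=\int\!\!\int\big(\sqrt{p_\theta(s'\mid s,a)}-\sqrt{p_{\theta'}(s'\mid s,a)}\big)^2dm(s')\,\mu(s,a)\,d\lambda(s,a)\in[0,\infty].$$ Let $N(\epsilon,T,d)$ be the minimal number of $d$-balls of radius $\epsilon$ that cover $T$. With $K(p_1;p_2)=\mathbb E_{p_1}\log\frac{p_1}{p_2}$ and $V_n(p_1;p_2)=\mathbb E_{p_1}\big(\log\frac{p_1}{p_2}-K(p_1;p_2)\big)^n$, put $$B_t(\theta_0,\epsilon;n)=\{\theta: K(p^{(t)}_{\theta_0,\pi};p^{(t)}_{\theta,\pi})\le t\epsilon^2,\ V_n(p^{(t)}_{\theta_0,\pi};p^{(t)}_{\theta,\pi})\le t^{n/2}\epsilon^n\}$$ (for membership both quantities must be well defined and finite). For a prior $P_t$ on $\Theta$ the posterior is $$P_t(C\mid H_t)=\int_C\prod_{i<t}p_\theta(S_{i+1}\mid S_i,A_i)\,dP_t(\theta)\Big/\int_\Theta\prod_{i<t}p_\theta(S_{i+1}\mid S_i,A_i)\,dP_t(\theta).$$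 **Assumption A4** (for the policy $\pi$, positive integers $k,l$, a non-increasing sequence of positive numbers $(\alpha_i)_{i\ge0}$ and non-negative functions $\mu,\nu$): for all $\theta\in\Theta$, all $i\ge0$ and $P_{\theta,\pi}$-almost all $\widetilde H_i$, $$\alpha_i\,\mu\le\frac1k\sum_{j=1}^kp^{\widetilde H_i,j}_{\theta,\pi},\qquad p^{\widetilde H_i,l}_{\theta,\pi}\le\nu .$$ **Theorem.** Let the model, $\lambda$, $\pi$, $k,l$, $(\alpha_i)$, $\mu,\nu$ be as above, and write $N_t=\lfloor t/(k+l)\rfloor$. There are constants $K>0$ and $\xi\in(0,1)$ such that for every initial distribution $\iota$ for which Assumption A4 holds: 1. (Tests.) For all $\theta_0,\theta_1\in\Theta$ and all $t$ there is a measurable test $\phi_t=\phi_t(H_t)\in[0,1]$ with $$\mathbb E_{\theta_0,\pi}\phi_t\le e^{-K\sum_{i=0}^{N_t-1}\alpha_{i(k+l)}d_\mu^2(\theta_0,\theta_1)},\qquad \sup_{\theta\in B}\mathbb E_{\theta,\pi}(1-\phi_t)\le e^{-K\sum_{i=0}^{N_t-1}\alpha_{i(k+l)}d_\mu^2(\theta_0,\theta_1)},$$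 where $B=\{\theta: d_\nu(\theta,\theta_1)\le\xi\,\alpha_{(N_t-1)(k+l)}^{1/2}d_\mu(\theta_0,\theta_1)\}$ (for $N_t=0$ the bounds are trivial). 2. (Posterior rate.) With the same $K$ and $\xi$: let $\theta_0\in\Theta$, $n\in\mathbb N$, let $P_t$ be probability measures on $\Theta$, let $\epsilon_t>0$, $\epsilon_t\to0$, $\bar\epsilon_t=\big(\sum_{i=0}^{N_t-1}\alpha_{i(k+l)}\epsilon_t^2/t\big)^{1/2}$ and $1/(t\bar\epsilon_t^2)=O(1)$. Suppose that for all sufficiently large $t$ $$\sup_{\epsilon>\epsilon_t}\log N\Big(\tfrac12\alpha_{(N_t-1)(k+l)}^{1/2}\,\xi\,\epsilon,\ \{\theta:d_\mu(\theta,\theta_0)<\epsilon\},\ d_\nu\Big)\le t\bar\epsilon_t^2,$$ and that there is $J$ such that, for all sufficiently large $t$, $P_t(B_t(\theta_0,\bar\epsilon_t;n))>0$ and, for all $j\ge J$, $$\frac{P_t(\theta:j\epsilon_t<d_\mu(\theta,\theta_0)\le(j+1)\epsilon_t)}{P_t(B_t(\theta_0,\bar\epsilon_t;n))}\le\exp\{Kt\bar\epsilon_t^2j^2/2\}.$$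 Then for every sequence $M_t\to\infty$, $$P_t(\theta\in\Theta:d_\mu(\theta,\theta_0)>M_t\epsilon_t\mid H_t)\to0\quad\text{in }P_{\theta_0,\pi}\text{-probability}.$$ -/

import Mathlib

open MeasureTheory ProbabilityTheory Filter Topology
open scoped ENNReal NNReal

noncomputable section

namespace MDP

/-- One step `(S_t, A_t, R_t)` of the process. -/
abbrev Step (S A : Type*) := S × A × ℝ

/-- The history `H_t = (S_0, A_0, R_0, …, S_{t-1}, A_{t-1}, R_{t-1}, S_t)`. -/
abbrev Hist (S A : Type*) (t : ℕ) := (Fin t → Step S A) × S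

/-- The extended history `H̃_t = (H_t, A_t, R_t)`, that is, the steps `0, …, t`. -/
abbrev ExtHist (S A : Type*) (t : ℕ) := (Finset.Iic t) → Step S A

/-- An infinite trajectory of the process. -/
abbrev Traj (S A : Type*) := ℕ → Step S A

variable {Θ S A : Type*} [MeasurableSpace Θ] [MeasurableSpace S] [MeasurableSpace A]

/-- A family of Markov decision processes indexed by the parameter `θ ∈ Θ`: a reward function and
transition densities `dens θ (s, a) s' = p_θ(s' | s, a)` with respect to a reference measure
`base` on the state space. -/
structure Model (Θ S A : Type*) [MeasurableSpace Θ] [MeasurableSpace S] [MeasurableSpace A] where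
  reward : S × A → ℝ
  measurable_reward : Measurable reward
  base : Measure S
  sigmaFinite_base : SigmaFinite base
  dens : Θ → S × A → S → ℝ≥0
  measurable_dens : Measurable fun x : Θ × (S × A) × S => dens x.1 x.2.1 x.2.2
  lintegral_dens : ∀ θ x, ∫⁻ s', (dens θ x s' : ℝ≥0∞) ∂base = 1

/-- A policy: at every time `t` a Markov kernel from the history `H_t` to the actions. -/
structure Policy (S A : Type*) [MeasurableSpace S] [MeasurableSpace A] where
  kernel : ∀ t, Kernel (Hist S A t) A
  isMarkovKernel : ∀ t, IsMarkovKernel (kernel t)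

instance (M : Model Θ S A) : SigmaFinite M.base := M.sigmaFinite_base

instance (π : Policy S A) (t : ℕ) : IsMarkovKernel (π.kernel t) := π.isMarkovKernel t

/-- The last state-action pair `(S_t, A_t)` of `H̃_t`. -/
def lastPair (t : ℕ) (h : ExtHist S A t) : S × A :=
  ((h ⟨t, Finset.mem_Iic.2 le_rfl⟩).1, (h ⟨t, Finset.mem_Iic.2 le_rfl⟩).2.1)

theorem measurable_lastPair (t : ℕ) : Measurable (lastPair (S := S) (A := A) t) := by
  unfold lastPair; fun_prop

/-- `H_{t+1}` as a function of `H̃_t` and the new state `S_{t+1}`. -/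
def extend (t : ℕ) (x : ExtHist S A t × S) : Hist S A (t + 1) :=
  (fun i => x.1 ⟨i, Finset.mem_Iic.2 (Nat.lt_succ_iff.1 i.2)⟩, x.2)

theorem measurable_extend (t : ℕ) : Measurable (extend (S := S) (A := A) t) := by
  unfold extend; fun_prop

/-- Append the reward to a state-action pair. -/
def Model.addReward (M : Model Θ S A) (x : S × A) : Step S A := (x.1, x.2, M.reward x)

theorem Model.measurable_addReward (M : Model Θ S A) : Measurable M.addReward := by
  have := M.measurable_reward
  unfold Model.addReward; fun_prop

/-- The transition kernel `(s, a) ↦ p_θ(s' | s, a) dm(s')`. -/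
def Model.transition (M : Model Θ S A) (θ : Θ) : Kernel (S × A) S :=
  Kernel.withDensity (Kernel.const (S × A) M.base) fun x s' => (M.dens θ x s' : ℝ≥0∞)

theorem Model.measurable_uncurry_dens (M : Model Θ S A) (θ : Θ) :
    Measurable (Function.uncurry fun x s' => (M.dens θ x s' : ℝ≥0∞)) :=
  (M.measurable_dens.comp (measurable_const.prodMk measurable_id)).coe_nnreal_ennreal

instance (M : Model Θ S A) (θ : Θ) : IsMarkovKernel (M.transition θ) := by
  refine ⟨fun x => ⟨?_⟩⟩
  rw [Model.transition, Kernel.withDensity_apply' _ (M.measurable_uncurry_dens θ)]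
  simpa using M.lintegral_dens θ x

/-- The conditional law of `(S_{t+1}, A_{t+1}, R_{t+1})` given `H̃_t` under the dynamics `θ` and the
policy `π`. -/
def Model.stepKernel (M : Model Θ S A) (π : Policy S A) (θ : Θ) (t : ℕ) :
    Kernel (ExtHist S A t) (Step S A) :=
  ((M.transition θ).comap (lastPair t) (measurable_lastPair t) ⊗ₖ
    (π.kernel (t + 1)).comap (extend t) (measurable_extend t)).map M.addReward

instance (M : Model Θ S A) (π : Policy S A) (θ : Θ) (t : ℕ) :
    IsMarkovKernel (M.stepKernel π θ t) :=
  Kernel.IsMarkovKernel.map _ M.measurable_addReward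

/-- The conditional law of the whole trajectory given `H̃_t`. -/
def Model.trajFrom (M : Model Θ S A) (π : Policy S A) (θ : Θ) (t : ℕ) :
    Kernel (ExtHist S A t) (Traj S A) :=
  Kernel.traj (X := fun _ => Step S A) (M.stepKernel π θ) t

/-- The law of `(S_0, A_0, R_0)`, when `S_0` has the law `ι`, as a law of `H̃_0`. -/
def Model.initLaw (M : Model Θ S A) (π : Policy S A) (ι : Measure S) :
    Measure (ExtHist S A 0) :=
  (ι ⊗ₘ (π.kernel 0).comap (fun s => ((Fin.elim0 : Fin 0 → Step S A), s))
    (measurable_const.prodMk measurable_id)).map fun x _ => M.addReward x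

/-- `P_{θ,π}`: the law of the trajectory under the dynamics `θ`, the policy `π` and the initial
state distribution `ι`. -/
def Model.law (M : Model Θ S A) (π : Policy S A) (ι : Measure S) (θ : Θ) :
    Measure (Traj S A) :=
  (M.initLaw π ι).bind (M.trajFrom π θ 0)

/-- The history `H_t` of a trajectory. -/
def hist (t : ℕ) (ω : Traj S A) : Hist S A t := (fun i => ω i, (ω t).1)

/-- The extended history `H̃_t` of a trajectory. -/
def extHist (t : ℕ) (ω : Traj S A) : ExtHist S A t := fun i => ω i

/-- The law of `H_t` under `P_{θ,π}`. -/
def Model.histLaw (M : Model Θ S A) (π : Policy S A) (ι : Measure S) (θ : Θ) (t : ℕ) :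
    Measure (Hist S A t) :=
  (M.law π ι θ).map (hist t)

/-- `P_{θ,π}^{H̃_i, j}`: the conditional law of `(S_{i+j}, A_{i+j})` given `H̃_i = h`. -/
def Model.condPairLaw (M : Model Θ S A) (π : Policy S A) (θ : Θ) (i j : ℕ)
    (h : ExtHist S A i) : Measure (S × A) :=
  (M.trajFrom π θ i h).map fun ω => ((ω (i + j)).1, (ω (i + j)).2.1)

/-- The two-sided bounds on the multi-step state-action densities. The inequality
`α_i μ ≤ (1/k) ∑_{j=1}^k p^{H̃_i, j}` between densities with respect to `lam` is meant
`lam`-almost everywhere, that is, it is the inequality between the measures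
`α_i μ dλ` and `(1/k) ∑_{j=1}^k P^{H̃_i, j}`, and likewise for `p^{H̃_i, l} ≤ ν`.
The bounds are required for almost every `H̃_i` under the law of `H̃_i` induced by `θ` and `π`. -/
structure UniformBounds (M : Model Θ S A) (lam : Measure (S × A)) (π : Policy S A)
    (ι : Measure S) (k l : ℕ) (α : ℕ → ℝ) (μ ν : S × A → ℝ≥0) : Prop where
  lower : ∀ θ : Θ, ∀ i : ℕ, ∀ᵐ h ∂((M.law π ι θ).map (extHist i)),
    ENNReal.ofReal (α i) • lam.withDensity (fun x => (μ x : ℝ≥0∞)) ≤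
      (k : ℝ≥0∞)⁻¹ • ∑ j ∈ Finset.Icc 1 k, M.condPairLaw π θ i j h
  upper : ∀ θ : Θ, ∀ i : ℕ, ∀ᵐ h ∂((M.law π ι θ).map (extHist i)),
    M.condPairLaw π θ i l h ≤ lam.withDensity (fun x => (ν x : ℝ≥0∞))

/-- The squared Hellinger distance `∫ (√p_θ(s'|x) - √p_θ'(s'|x))² dm(s')`. -/
def Model.hellingerSq (M : Model Θ S A) (θ θ' : Θ) (x : S × A) : ℝ≥0∞ :=
  ∫⁻ s', ENNReal.ofReal ((√(M.dens θ x s' : ℝ) - √(M.dens θ' x s' : ℝ)) ^ 2) ∂M.base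

/-- The semi-distance `d_μ(θ, θ') = (∫ h²(p_θ(·|s,a), p_θ'(·|s,a)) μ(s,a) dλ(s,a))^{1/2}`, with the
value `∞` where the integral diverges. -/
def Model.dist (M : Model Θ S A) (lam : Measure (S × A)) (μ : S × A → ℝ≥0) (θ θ' : Θ) : ℝ≥0∞ :=
  (∫⁻ x, M.hellingerSq θ θ' x * (μ x : ℝ≥0∞) ∂lam) ^ (1 / 2 : ℝ)

/-- The `r`-covering number of `T` with respect to `d`: the minimal number of (closed) `d`-balls of
radius `r` that cover `T`. -/
def coveringNumber (r : ℝ≥0∞) (T : Set Θ) (d : Θ → Θ → ℝ≥0∞) : ℕ∞ :=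
  ⨅ (C : Set Θ) (_ : ∀ θ ∈ T, ∃ c ∈ C, d θ c ≤ r), C.encard

/-- The moment condition `V_n(P; Q) = E_P (log (dP/dQ) - K(P; Q))^n ≤ b`, the moment being required
to exist. -/
def MomentLE {X : Type*} [MeasurableSpace X] (P Q : Measure X) (n : ℕ) (b : ℝ) : Prop :=
  Integrable (fun x => (llr P Q x - (InformationTheory.klDiv P Q).toReal) ^ n) P ∧
    ∫ x, (llr P Q x - (InformationTheory.klDiv P Q).toReal) ^ n ∂P ≤ b

/-- The Kullback-Leibler type neighbourhood `B_t(θ₀, ε; n)`. -/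
def Model.klBall (M : Model Θ S A) (π : Policy S A) (ι : Measure S) (θ₀ : Θ) (t : ℕ) (ε : ℝ)
    (n : ℕ) : Set Θ :=
  {θ | InformationTheory.klDiv (M.histLaw π ι θ₀ t) (M.histLaw π ι θ t) ≤
        ENNReal.ofReal (t * ε ^ 2) ∧
      MomentLE (M.histLaw π ι θ₀ t) (M.histLaw π ι θ t) n ((t : ℝ) ^ ((n : ℝ) / 2) * ε ^ n)}

/-- The likelihood `∏_{i < t} p_θ(S_{i+1} | S_i, A_i)`: the density of `H_t`, up to the contribution
of the initial state and of the policy, which does not depend on `θ`. -/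
def Model.likelihood (M : Model Θ S A) (t : ℕ) (h : Hist S A t) (θ : Θ) : ℝ≥0∞ :=
  ∏ i : Fin t, (M.dens θ ((h.1 i).1, (h.1 i).2.1)
    (if hi : (i : ℕ) + 1 < t then (h.1 ⟨i + 1, hi⟩).1 else h.2) : ℝ≥0∞)

/-- The posterior mass `P(C | H_t = h)` of `C` for the prior `P`, by Bayes' formula. -/
def Model.posterior (M : Model Θ S A) (P : Measure Θ) (t : ℕ) (h : Hist S A t) (C : Set Θ) :
    ℝ≥0∞ :=
  (∫⁻ θ in C, M.likelihood t h θ ∂P) / ∫⁻ θ, M.likelihood t h θ ∂P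

/-- `∑_{i=0}^{⌊t/(k+l)⌋-1} α_{i(k+l)}`. -/
def alphaSum (k l : ℕ) (α : ℕ → ℝ) (t : ℕ) : ℝ :=
  ∑ i ∈ Finset.range (t / (k + l)), α (i * (k + l))

/-- `α_{(⌊t/(k+l)⌋-1)(k+l)}`, which is only of interest for `t ≥ k + l`. -/
def alphaLast (k l : ℕ) (α : ℕ → ℝ) (t : ℕ) : ℝ := α ((t / (k + l) - 1) * (k + l))

/-- `ε̄_t = (∑_{i=0}^{⌊t/(k+l)⌋-1} α_{i(k+l)} ε_t² / t)^{1/2}`. -/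
def epsBar (k l : ℕ) (α ε : ℕ → ℝ) (t : ℕ) : ℝ := √(alphaSum k l α t * ε t ^ 2 / t)

/-- `K` and `ξ` are admissible constants for the testing problem: for all `θ₀, θ₁` and all `t` there
is a (randomized) test `φ_t`, based on `H_t`, of `θ₀` against the `d_ν`-ball of radius
`ξ α_{(⌊t/(k+l)⌋-1)(k+l)}^{1/2} d_μ(θ₀, θ₁)` around `θ₁`, both error probabilities of which are at
most `exp (-K ∑_i α_{i(k+l)} d_μ²(θ₀, θ₁))`. -/
def HasTests (M : Model Θ S A) (lam : Measure (S × A)) (π : Policy S A) (ι : Measure S) (k l : ℕ)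
    (α : ℕ → ℝ) (μ ν : S × A → ℝ≥0) (K ξ : ℝ) : Prop :=
  ∀ θ₀ θ₁ : Θ, ∀ t : ℕ, ∃ φ : Hist S A t → ℝ, Measurable φ ∧ (∀ h, 0 ≤ φ h ∧ φ h ≤ 1) ∧
    ∫ ω, φ (hist t ω) ∂(M.law π ι θ₀) ≤
      Real.exp (-K * alphaSum k l α t * (M.dist lam μ θ₀ θ₁).toReal ^ 2) ∧
    ∀ θ : Θ,
      M.dist lam ν θ θ₁ ≤
        ENNReal.ofReal (ξ * √(alphaLast k l α t)) * M.dist lam μ θ₀ θ₁ →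
      ∫ ω, (1 - φ (hist t ω)) ∂(M.law π ι θ) ≤
        Real.exp (-K * alphaSum k l α t * (M.dist lam μ θ₀ θ₁).toReal ^ 2)

/-- The entropy condition at time `t`:
`sup_{r > ε_t} log N(½ α_{(⌊t/(k+l)⌋-1)(k+l)}^{1/2} ξ r, {θ : d_μ(θ, θ₀) < r}, d_ν) ≤ t ε̄_t²`. -/
def EntropyBound (M : Model Θ S A) (lam : Measure (S × A)) (k l : ℕ) (α : ℕ → ℝ)
    (μ ν : S × A → ℝ≥0) (ξ : ℝ) (θ₀ : Θ) (ε : ℕ → ℝ) (t : ℕ) : Prop :=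
  ⨆ r : Set.Ioi (ε t), ENNReal.log (ENat.toENNReal (coveringNumber
      (ENNReal.ofReal (1 / 2 * √(alphaLast k l α t) * ξ * r))
      {θ : Θ | M.dist lam μ θ θ₀ < ENNReal.ofReal r} (M.dist lam ν))) ≤
    ((t * epsBar k l α ε t ^ 2 : ℝ) : EReal)

/-- The prior mass condition at time `t` for the shell with index `j`:
`P_t(j ε_t < d_μ(θ, θ₀) ≤ (j+1) ε_t) / P_t(B_t(θ₀, ε̄_t; n)) ≤ exp (K t ε̄_t² j² / 2)`. -/
def PriorBound (M : Model Θ S A) (lam : Measure (S × A)) (π : Policy S A) (ι : Measure S)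
    (k l : ℕ) (α : ℕ → ℝ) (μ : S × A → ℝ≥0) (K : ℝ) (θ₀ : Θ) (ε : ℕ → ℝ) (P : Measure Θ)
    (n t j : ℕ) : Prop :=
  P {θ | ENNReal.ofReal (j * ε t) < M.dist lam μ θ θ₀ ∧
        M.dist lam μ θ θ₀ ≤ ENNReal.ofReal ((j + 1) * ε t)} /
      P (M.klBall π ι θ₀ t (epsBar k l α ε t) n) ≤
    ENNReal.ofReal (Real.exp (K * t * epsBar k l α ε t ^ 2 * j ^ 2 / 2))

end MDP

end

noncomputable section

namespace MDP

variable {Θ S A : Type*} [MeasurableSpace Θ] [MeasurableSpace S] [MeasurableSpace A]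

/-! Tests. Write a, b, c for the square roots of the transition densities of θ₀, θ₁ and the true θ.
The score (b − a)/(a + b) is bounded by 1, so its exponential can be expanded to second order.
Integrating the pointwise bound `sq_mul_exp_score_le` gives, for one transition from x, E_θ
exp(−score/8) ≤ 1 − h²(θ₀,θ₁)(x)/128 + 9 h²(θ,θ₁)(x). The error term vanishes at θ = θ₁, so θ₁ can
be tested together with a neighbourhood.

The pair x is random and has to be averaged out. Time is cut into blocks of length k + l, and each
block uses the average score of k consecutive transitions. Given the past at the start of a block,
the lower half of A4 bounds the averaged gain below by α d_μ²(θ₀,θ₁). The l remaining steps of the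
preceding block let the upper half of A4 bound the loss by d_ν²(θ,θ₁). Jensen's inequality and
induction over the blocks (`lintegral_mul_exp_blockScore_le`, `lintegral_exp_totalScore_le`) bound
the exponential moment of the total score T. The test rejects when T ≥ 0. Markov's inequality for
exp(±T/8) controls both errors; the score changes sign when θ₀ and θ₁ are exchanged, so one moment
bound serves both.

Posterior. The set d_μ(θ,θ₀) > M ε_t is split into shells of width ε_t. The entropy bound covers a
shell by few d_ν-balls, and the supremum of the local tests is a test against the whole shell
(`exists_test_shell`). Outside the rejection region, Fubini bounds the expected posterior numerator
by prior mass times type II error. The denominator is bounded below by `histLaw_evidence_le`: a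
Kullback-Leibler bound x makes the likelihood ratio at θ smaller than e^{-a} only with probability
at most x/(a − 1), and this is averaged over the prior. Taking a of order x n² with n = ⌊M_t⌋ makes
this probability O(1/n²), while e^a still costs only a fraction of the exponent gained from the
tests. All resulting bounds tend to 0 as n grows. -/

theorem measurable_hist (t : ℕ) : Measurable (hist (S := S) (A := A) t) := by
  unfold hist; fun_prop

theorem measurable_extHist (t : ℕ) : Measurable (extHist (S := S) (A := A) t) := by
  unfold extHist; fun_prop

theorem measurable_extHist_prodMk (t : ℕ) :
    Measurable fun ω : Traj S A => (extHist t ω, ω) :=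
  (measurable_extHist t).prodMk measurable_id

instance (M : Model Θ S A) (π : Policy S A) (ι : Measure S) [IsProbabilityMeasure ι] :
    IsProbabilityMeasure (M.initLaw π ι) := by
  refine Measure.isProbabilityMeasure_map (Measurable.aemeasurable ?_)
  have := M.measurable_addReward
  fun_prop

instance (M : Model Θ S A) (π : Policy S A) (θ : Θ) (t : ℕ) :
    IsMarkovKernel (M.trajFrom π θ t) := by
  unfold Model.trajFrom; infer_instance

instance (M : Model Θ S A) (π : Policy S A) (ι : Measure S) [IsProbabilityMeasure ι] (θ : Θ) :
    IsProbabilityMeasure (M.law π ι θ) := by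
  unfold Model.law; infer_instance

instance (M : Model Θ S A) (π : Policy S A) (ι : Measure S) [IsProbabilityMeasure ι] (θ : Θ)
    (t : ℕ) : IsProbabilityMeasure ((M.law π ι θ).map (extHist t)) :=
  Measure.isProbabilityMeasure_map (measurable_extHist t).aemeasurable

instance (M : Model Θ S A) (π : Policy S A) (ι : Measure S) [IsProbabilityMeasure ι] (θ : Θ)
    (t : ℕ) : IsProbabilityMeasure (M.histLaw π ι θ t) :=
  Measure.isProbabilityMeasure_map (measurable_hist t).aemeasurable

/-! ### Markov property and one-step kernels -/

/-- The Markov property: the trajectory disintegrates along `H̃_i` with kernel `trajFrom i`. -/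
theorem map_extHist_prodMk_law (M : Model Θ S A) (π : Policy S A) (ι : Measure S)
    [IsProbabilityMeasure ι] (θ : Θ) (i : ℕ) :
    (M.law π ι θ).map (fun ω => (extHist i ω, ω)) =
      (M.law π ι θ).map (extHist i) ⊗ₘ M.trajFrom π θ i := by
  have h1 : (M.law π ι θ).map (extHist i) =
      (M.initLaw π ι).bind (Kernel.partialTraj (X := fun _ => Step S A) (M.stepKernel π θ) 0 i) := by
    have : Kernel.partialTraj (X := fun _ => Step S A) (M.stepKernel π θ) 0 i =
        (M.trajFrom π θ 0).map (extHist i) :=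
      (Kernel.traj_map_frestrictLe (X := fun _ => Step S A) (κ := M.stepKernel π θ) 0 i).symm
    rw [this, Model.law, Measure.map_comp _ _ (measurable_extHist i)]
  rw [h1]
  refine Measure.ext_of_lintegral _ fun f hf => ?_
  have hm := measurable_extHist_prodMk (S := S) (A := A) i
  have hfm : Measurable fun ω : Traj S A => f (extHist i ω, ω) := hf.comp hm
  rw [lintegral_map hf hm, Model.law,
    Measure.lintegral_bind (Kernel.measurable _).aemeasurable hfm.aemeasurable,
    Measure.lintegral_compProd hf,
    Measure.lintegral_bind (Kernel.measurable _).aemeasurable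
      hf.lintegral_kernel_prod_right'.aemeasurable]
  refine lintegral_congr fun u => ?_
  rw [← Measure.lintegral_compProd hf]
  -- For fixed initial step this is the consistency of the Ionescu-Tulcea kernels: run to time i,
  -- then continue from there.
  have := Kernel.partialTraj_compProd_traj (X := fun _ => Step S A) (κ := M.stepKernel π θ)
    (Nat.zero_le i) u
  change _ = ∫⁻ x, f x ∂(_ ⊗ₘ Kernel.traj (X := fun _ => Step S A) (M.stepKernel π θ) i)
  rw [this, lintegral_map hf (by fun_prop)]
  rfl

theorem lintegral_extHist_law (M : Model Θ S A) (π : Policy S A) (ι : Measure S)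
    [IsProbabilityMeasure ι] (θ : Θ) (i : ℕ) {f : ExtHist S A i × Traj S A → ℝ≥0∞}
    (hf : Measurable f) :
    ∫⁻ ω, f (extHist i ω, ω) ∂(M.law π ι θ) =
      ∫⁻ h, ∫⁻ ω, f (h, ω) ∂(M.trajFrom π θ i h) ∂((M.law π ι θ).map (extHist i)) := by
  rw [← Measure.lintegral_compProd hf, ← map_extHist_prodMk_law,
    lintegral_map hf (measurable_extHist_prodMk i)]

theorem map_extHist_next_law (M : Model Θ S A) (π : Policy S A) (ι : Measure S)
    [IsProbabilityMeasure ι] (θ : Θ) (i : ℕ) :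
    (M.law π ι θ).map (fun ω => (extHist i ω, ω (i + 1))) =
      (M.law π ι θ).map (extHist i) ⊗ₘ M.stepKernel π θ i := by
  have h := Kernel.map_traj_succ_self (X := fun _ => Step S A) (κ := M.stepKernel π θ) (a := i)
  rw [← h, Measure.compProd_map (by fun_prop)]
  change _ = Measure.map _ (_ ⊗ₘ M.trajFrom π θ i)
  rw [← map_extHist_prodMk_law, Measure.map_map (by fun_prop)
    (measurable_extHist_prodMk i)]
  rfl

theorem lintegral_stepKernel (M : Model Θ S A) (π : Policy S A) (θ : Θ) (t : ℕ)
    (h : ExtHist S A t) {f : Step S A → ℝ≥0∞} (hf : Measurable f) :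
    ∫⁻ y, f y ∂(M.stepKernel π θ t h) =
      ∫⁻ s, M.dens θ (lastPair t h) s *
        ∫⁻ a, f (M.addReward (s, a)) ∂(π.kernel (t + 1) (extend t (h, s))) ∂M.base := by
  have hm : Measurable fun x => f (M.addReward x) := hf.comp M.measurable_addReward
  rw [Model.stepKernel, Kernel.lintegral_map _ M.measurable_addReward _ hf,
    Kernel.lintegral_compProd _ _ _ hm, Kernel.lintegral_comap, Model.transition,
    Kernel.lintegral_withDensity _ (M.measurable_uncurry_dens θ)]
  · rfl
  · exact Measurable.lintegral_kernel_prod_right' (κ := ((π.kernel (t + 1)).comap (extend t)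
      (measurable_extend t)).comap (Prod.mk h) measurable_prodMk_left) (f := fun p : S × A => f (M.addReward p)) hm

/-- The kernel `stepKernel` with the transition law replaced by the reference measure. -/
def Model.baseStepKernel (M : Model Θ S A) (π : Policy S A) (t : ℕ) :
    Kernel (ExtHist S A t) (Step S A) :=
  (Kernel.const _ M.base ⊗ₖ
    (π.kernel (t + 1)).comap (extend t) (measurable_extend t)).map M.addReward

instance (M : Model Θ S A) (π : Policy S A) (t : ℕ) : IsSFiniteKernel (M.baseStepKernel π t) := by
  unfold Model.baseStepKernel; infer_instance

theorem lintegral_baseStepKernel (M : Model Θ S A) (π : Policy S A) (t : ℕ)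
    (h : ExtHist S A t) {f : Step S A → ℝ≥0∞} (hf : Measurable f) :
    ∫⁻ y, f y ∂(M.baseStepKernel π t h) =
      ∫⁻ s, ∫⁻ a, f (M.addReward (s, a)) ∂(π.kernel (t + 1) (extend t (h, s))) ∂M.base := by
  have hm : Measurable fun x => f (M.addReward x) := hf.comp M.measurable_addReward
  rw [Model.baseStepKernel, Kernel.lintegral_map _ M.measurable_addReward _ hf,
    Kernel.lintegral_compProd _ _ _ hm, Kernel.const_apply]
  rfl

/-- All dependence on θ is isolated in one density factor; `baseStepKernel` is common to all
parameters. This is what makes the likelihood a density in `exists_extHist_withDensity`. -/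
theorem lintegral_stepKernel_eq_base (M : Model Θ S A) (π : Policy S A) (θ : Θ) (t : ℕ)
    (h : ExtHist S A t) {f : Step S A → ℝ≥0∞} (hf : Measurable f) :
    ∫⁻ y, f y ∂(M.stepKernel π θ t h) =
      ∫⁻ y, M.dens θ (lastPair t h) y.1 * f y ∂(M.baseStepKernel π t h) := by
  have hd : Measurable fun s => (M.dens θ (lastPair t h) s : ℝ≥0∞) :=
    (M.measurable_uncurry_dens θ).of_uncurry_left
  have hdf : Measurable fun y : Step S A => (M.dens θ (lastPair t h) y.1 : ℝ≥0∞) * f y :=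
    (hd.comp measurable_fst).mul hf
  rw [lintegral_stepKernel M π θ t h hf, lintegral_baseStepKernel M π t h hdf]
  refine lintegral_congr fun s => ?_
  rw [← lintegral_const_mul _ (by have := M.measurable_addReward; fun_prop)]
  rfl

/-! ### The likelihood as a density of the history -/

/-- The likelihood as a function of the extended history. -/
def Model.extLikelihood (M : Model Θ S A) (θ : Θ) (t : ℕ) (h : ExtHist S A t) : ℝ≥0∞ :=
  ∏ i : Fin t, (M.dens θ
    ((h ⟨i, Finset.mem_Iic.2 i.2.le⟩).1, (h ⟨i, Finset.mem_Iic.2 i.2.le⟩).2.1)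
    (h ⟨i + 1, Finset.mem_Iic.2 i.2⟩).1 : ℝ≥0∞)

theorem measurable_dens_comp (M : Model Θ S A) {X : Type*} [MeasurableSpace X] {f : X → Θ}
    {g : X → S × A} {s : X → S} (hf : Measurable f) (hg : Measurable g) (hs : Measurable s) :
    Measurable fun x => M.dens (f x) (g x) (s x) :=
  M.measurable_dens.comp (hf.prodMk (hg.prodMk hs))

theorem measurable_extLikelihood (M : Model Θ S A) (θ : Θ) (t : ℕ) :
    Measurable (M.extLikelihood θ t) := by
  refine Finset.measurable_fun_prod _ fun i _ => (measurable_dens_comp M ?_ ?_ ?_).coe_nnreal_ennreal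
    <;> fun_prop

/-- Append a step to an extended history. -/
def snocExt (t : ℕ) (x : ExtHist S A t × Step S A) : ExtHist S A (t + 1) :=
  fun i => if hi : (i : ℕ) ≤ t then x.1 ⟨i, Finset.mem_Iic.2 hi⟩ else x.2

theorem measurable_snocExt (t : ℕ) : Measurable (snocExt (S := S) (A := A) t) := by
  refine measurable_pi_lambda _ fun i => ?_
  unfold snocExt
  split_ifs <;> fun_prop

theorem snocExt_extHist {S A : Type*} (t : ℕ) (ω : Traj S A) :
    snocExt t (extHist t ω, ω (t + 1)) = extHist (t + 1) ω := by
  funext i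
  have := Finset.mem_Iic.1 i.2
  unfold snocExt extHist
  split_ifs with h
  · rfl
  · rw [show (i : ℕ) = t + 1 by lia]

theorem extLikelihood_snocExt (M : Model Θ S A) (θ : Θ) (t : ℕ) (x : ExtHist S A t × Step S A) :
    M.extLikelihood θ (t + 1) (snocExt t x) =
      M.extLikelihood θ t x.1 * M.dens θ (lastPair t x.1) x.2.1 := by
  have h1 : ∀ i : Fin t, (i : ℕ) ≤ t := fun i => i.2.le
  simp [Model.extLikelihood, Fin.prod_univ_castSucc, snocExt, lastPair, h1]

theorem map_extHist_succ_law (M : Model Θ S A) (π : Policy S A) (ι : Measure S)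
    [IsProbabilityMeasure ι] (θ : Θ) (t : ℕ) :
    (M.law π ι θ).map (extHist (t + 1)) =
      ((M.law π ι θ).map (extHist t) ⊗ₘ M.stepKernel π θ t).map (snocExt t) := by
  rw [← map_extHist_next_law, Measure.map_map (measurable_snocExt t)
    ((measurable_extHist t).prodMk (by fun_prop))]
  congr 1
  funext ω
  exact (snocExt_extHist t ω).symm

theorem map_extHist_zero_law (M : Model Θ S A) (π : Policy S A) (ι : Measure S) (θ : Θ) :
    (M.law π ι θ).map (extHist 0) = M.initLaw π ι := by
  have : (M.trajFrom π θ 0).map (extHist 0) = Kernel.id := by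
    have := Kernel.traj_map_frestrictLe (X := fun _ => Step S A) (κ := M.stepKernel π θ) 0 0
    rwa [Kernel.partialTraj_self] at this
  rw [Model.law, Measure.map_comp _ _ (measurable_extHist 0), this]
  exact Measure.id_comp

/-- The dominating measure runs the same initial law and policy but draws each new state from m. It
is built by induction, each step contributing one density factor. It need not be finite, only
s-finite. -/
theorem exists_extHist_withDensity (M : Model Θ S A) (π : Policy S A) (ι : Measure S)
    [IsProbabilityMeasure ι] (t : ℕ) :
    ∃ R : Measure (ExtHist S A t), SFinite R ∧
      ∀ θ, (M.law π ι θ).map (extHist t) = R.withDensity (M.extLikelihood θ t) := by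
  induction t with
  | zero =>
    refine ⟨M.initLaw π ι, inferInstance, fun θ => ?_⟩
    rw [map_extHist_zero_law]
    have : M.extLikelihood θ 0 = 1 := funext fun h => Finset.prod_empty
    rw [this, withDensity_one]
  | succ t ih =>
    obtain ⟨R, hR, h⟩ := ih
    refine ⟨(R ⊗ₘ M.baseStepKernel π t).map (snocExt t), inferInstance, fun θ => ?_⟩
    rw [map_extHist_succ_law]
    refine Measure.ext_of_lintegral _ fun f hf => ?_
    have hs := measurable_snocExt (S := S) (A := A) t
    have hL := measurable_extLikelihood M θ
    have hfs : Measurable fun x => f (snocExt t x) := hf.comp hs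
    have hd : Measurable fun x : ExtHist S A t × Step S A =>
        (M.dens θ (lastPair t x.1) x.2.1 : ℝ≥0∞) :=
      (measurable_dens_comp M measurable_const ((measurable_lastPair t).comp measurable_fst)
        (by fun_prop)).coe_nnreal_ennreal
    have hm := (hL (t + 1)).mul hf
    have hms : Measurable fun x => (M.extLikelihood θ (t + 1) * f) (snocExt t x) := hm.comp hs
    rw [lintegral_map hf hs, Measure.lintegral_compProd hfs, h,
      lintegral_withDensity_eq_lintegral_mul _ (hL t) hfs.lintegral_kernel_prod_right',
      lintegral_withDensity_eq_lintegral_mul _ (hL (t + 1)) hf, lintegral_map hm hs,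
      Measure.lintegral_compProd hms]
    refine lintegral_congr fun x => ?_
    have hfx : Measurable fun y => f (snocExt t (x, y)) := hfs.comp measurable_prodMk_left
    rw [Pi.mul_apply, lintegral_stepKernel_eq_base M π θ t x hfx,
      ← lintegral_const_mul]
    · refine lintegral_congr fun y => ?_
      rw [Pi.mul_apply, extLikelihood_snocExt, mul_assoc]
    · exact (hd.comp measurable_prodMk_left).mul hfx

/-- Forget the last action and reward. -/
def dropLast (t : ℕ) (h : ExtHist S A t) : Hist S A t :=
  (fun i => h ⟨i, Finset.mem_Iic.2 i.2.le⟩, (h ⟨t, Finset.mem_Iic.2 le_rfl⟩).1)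

theorem measurable_dropLast (t : ℕ) : Measurable (dropLast (S := S) (A := A) t) := by
  unfold dropLast; fun_prop

theorem likelihood_dropLast (M : Model Θ S A) (θ : Θ) (t : ℕ) (h : ExtHist S A t) :
    M.likelihood t (dropLast t h) θ = M.extLikelihood θ t h := by
  refine Finset.prod_congr rfl fun i _ => ?_
  congr 2
  dsimp only [dropLast]
  split_ifs with hi
  · rfl
  · congr 2
    exact Subtype.ext (show t = (i : ℕ) + 1 by lia)

theorem measurable_likelihood (M : Model Θ S A) (t : ℕ) :
    Measurable fun x : Hist S A t × Θ => M.likelihood t x.1 x.2 := by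
  refine Finset.measurable_fun_prod _ fun i _ => (measurable_dens_comp M ?_ ?_ ?_).coe_nnreal_ennreal
  · fun_prop
  · fun_prop
  · split_ifs <;> fun_prop

/-- The laws of `H_t` for all parameters have the likelihoods as densities with respect to a common
reference measure. -/
theorem exists_histLaw_withDensity (M : Model Θ S A) (π : Policy S A) (ι : Measure S)
    [IsProbabilityMeasure ι] (t : ℕ) :
    ∃ R : Measure (Hist S A t),
      ∀ θ, M.histLaw π ι θ t = R.withDensity fun h => M.likelihood t h θ := by
  obtain ⟨R, -, h⟩ := exists_extHist_withDensity M π ι t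
  refine ⟨R.map (dropLast t), fun θ => ?_⟩
  have hL : Measurable fun h => M.likelihood t h θ :=
    (measurable_likelihood M t).comp measurable_prodMk_right
  have h1 : M.histLaw π ι θ t = ((M.law π ι θ).map (extHist t)).map (dropLast t) := by
    rw [Measure.map_map (measurable_dropLast t) (measurable_extHist t)]
    rfl
  refine Measure.ext_of_lintegral _ fun f hf => ?_
  have hfd : Measurable fun x => f (dropLast t x) := hf.comp (measurable_dropLast t)
  rw [h1, h, lintegral_map hf (measurable_dropLast t),
    lintegral_withDensity_eq_lintegral_mul _ (measurable_extLikelihood M θ t) hfd,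
    lintegral_withDensity_eq_lintegral_mul _ hL hf,
    lintegral_map (hL.mul hf) (measurable_dropLast t)]
  refine lintegral_congr fun x => ?_
  simp only [Pi.mul_apply, likelihood_dropLast]

/-! ### The bounded score and the exponential bound for one transition -/

/-- The pointwise inequality behind the exponential bound for the score `(b - a) / (a + b)`. -/
theorem sq_mul_exp_score_le {a b c : ℝ} (ha : 0 ≤ a) (hb : 0 ≤ b) :
    c ^ 2 * Real.exp (-((b - a) / (a + b)) / 8) + b ^ 2 / 32 + (a - b) ^ 2 / 128 ≤
      c ^ 2 + a ^ 2 / 32 + 9 * (c - b) ^ 2 := by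
  rcases (add_nonneg ha hb).eq_or_lt with h0 | h0
  · have ha0 : a = 0 := by linarith
    have hb0 : b = 0 := by linarith
    subst ha0 hb0
    simp
    positivity
  -- Coordinates: p is the score, s = a + b and e = c − b is the deviation from the alternative. For
  -- c = b the exponential has a linear term −s²p/32. It is cancelled by b²/32 − a²/32 = s²p/32, so
  -- what remains is of order (sp)² = (a − b)².
  obtain ⟨p, hp⟩ : ∃ p, p = (b - a) / (a + b) := ⟨_, rfl⟩
  obtain ⟨s, hs⟩ : ∃ s, s = a + b := ⟨_, rfl⟩
  obtain ⟨e, he⟩ : ∃ e, e = c - b := ⟨_, rfl⟩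
  have hpl : -1 ≤ p := by rw [hp, le_div_iff₀ h0]; linarith
  have hpu : p ≤ 1 := by rw [hp, div_le_iff₀ h0]; linarith
  have hba : b - a = p * s := by rw [hp, hs]; field_simp
  have hb' : b = s * (1 + p) / 2 := by linarith
  have ha' : a = s * (1 - p) / 2 := by linarith
  have hexp : Real.exp (-p / 8) ≤ 1 - p / 8 + p ^ 2 / 64 := by
    have h1 : |(-p / 8 : ℝ)| ≤ 1 := by rw [abs_le]; constructor <;> linarith
    have h2 := (abs_le.1 (Real.abs_exp_sub_one_sub_id_le h1)).2
    nlinarith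
  rw [← hp]
  have hc : c = b + e := by linarith
  have h1 := mul_le_mul_of_nonneg_left hexp (sq_nonneg c)
  refine le_trans (by gcongr) (?_ : c ^ 2 * (1 - p / 8 + p ^ 2 / 64) + b ^ 2 / 32 +
    (a - b) ^ 2 / 128 ≤ _)
  rw [← he, hc, ha', hb']
  have hg : -p / 8 + p ^ 2 / 64 ≤ 1 := by nlinarith
  obtain ⟨r, hr⟩ : ∃ r, r = (1 + p) * (-1 / 8 + p / 64) := ⟨_, rfl⟩
  have hr1 : -(1 / 2) ≤ r := by rw [hr]; nlinarith
  have hr2 : r ≤ 1 / 2 := by rw [hr]; nlinarith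
  -- The polynomial is (7 − p)(1 + p). This is 256 times the slack in the e-free part after 6/256
  -- (sp)² has been set aside for the cross term.
  have h2 : 0 ≤ (s * p) ^ 2 * (7 + 6 * p - p ^ 2) :=
    mul_nonneg (sq_nonneg _) (by nlinarith)
  have h3 : 0 ≤ e ^ 2 * (1 - (-p / 8 + p ^ 2 / 64)) := mul_nonneg (sq_nonneg _) (by linarith)
  -- The cross term in c² = (b + e)², split by Young's inequality. The 8 e² here and the e² from
  -- `h3` make up the factor 9.
  have h4 : e * (s * p) * r ≤ 8 * e ^ 2 + 6 / 256 * (s * p) ^ 2 := by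
    have h5 : r ^ 2 ≤ 1 / 4 := by nlinarith
    have h6 := mul_le_mul_of_nonneg_right h5 (sq_nonneg (s * p))
    nlinarith [sq_nonneg (e - r * (s * p) / 16), sq_nonneg (s * p)]
  rw [hr] at h4
  nlinarith

/-- The bounded score `(√q - √p) / (√p + √q)` of a transition, where `p` and `q` are the densities
for the two parameters. -/
def Model.score (M : Model Θ S A) (θ θ' : Θ) (x : S × A) (s : S) : ℝ :=
  (√(M.dens θ' x s : ℝ) - √(M.dens θ x s : ℝ)) / (√(M.dens θ x s : ℝ) + √(M.dens θ' x s : ℝ))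

theorem score_swap (M : Model Θ S A) (θ θ' : Θ) (x : S × A) (s : S) :
    M.score θ' θ x s = -M.score θ θ' x s := by
  unfold Model.score
  rw [add_comm, ← neg_div, neg_sub]

theorem hellingerSq_comm (M : Model Θ S A) (θ θ' : Θ) (x : S × A) :
    M.hellingerSq θ θ' x = M.hellingerSq θ' θ x := by
  unfold Model.hellingerSq
  simp_rw [sub_sq_comm]

theorem hellingerSq_self (M : Model Θ S A) (θ : Θ) (x : S × A) : M.hellingerSq θ θ x = 0 := by
  simp [Model.hellingerSq]

theorem measurable_score (M : Model Θ S A) (θ θ' : Θ) :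
    Measurable fun p : (S × A) × S => M.score θ θ' p.1 p.2 := by
  have h : ∀ θ, Measurable fun p : (S × A) × S => √(M.dens θ p.1 p.2 : ℝ) := fun θ =>
    (measurable_dens_comp M measurable_const measurable_fst measurable_snd).coe_nnreal_real.sqrt
  exact ((h θ').sub (h θ)).div ((h θ).add (h θ'))

theorem measurable_hellingerSq (M : Model Θ S A) :
    Measurable fun p : Θ × Θ × (S × A) => M.hellingerSq p.1 p.2.1 p.2.2 := by
  refine Measurable.lintegral_prod_right' (ν := M.base)
    (f := fun q : (Θ × Θ × (S × A)) × S =>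
      ENNReal.ofReal ((√(M.dens q.1.1 q.1.2.2 q.2 : ℝ) - √(M.dens q.1.2.1 q.1.2.2 q.2 : ℝ)) ^ 2)) ?_
  refine ENNReal.measurable_ofReal.comp (Measurable.pow_const (Measurable.sub ?_ ?_) 2) <;>
    exact (measurable_dens_comp M (by fun_prop) (by fun_prop) (by fun_prop)).coe_nnreal_real.sqrt

theorem measurable_hellingerSq_right (M : Model Θ S A) (θ θ' : Θ) :
    Measurable (M.hellingerSq θ θ') :=
  (measurable_hellingerSq M).comp (measurable_const.prodMk (measurable_const.prodMk measurable_id))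

theorem measurable_dens_right (M : Model Θ S A) (θ : Θ) (x : S × A) : Measurable (M.dens θ x) :=
  measurable_dens_comp M measurable_const measurable_const measurable_id

theorem hellingerSq_le_two (M : Model Θ S A) (θ θ' : Θ) (x : S × A) :
    M.hellingerSq θ θ' x ≤ 2 := by
  calc M.hellingerSq θ θ' x
      ≤ ∫⁻ s, ((M.dens θ x s : ℝ≥0∞) + M.dens θ' x s) ∂M.base := by
        refine lintegral_mono fun s => ?_
        rw [← ENNReal.coe_add, ENNReal.ofReal_le_iff_le_toReal ENNReal.coe_ne_top]
        have h1 := Real.sq_sqrt (M.dens θ x s).coe_nonneg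
        have h2 := Real.sq_sqrt (M.dens θ' x s).coe_nonneg
        have h3 := mul_nonneg (Real.sqrt_nonneg (M.dens θ x s)) (Real.sqrt_nonneg (M.dens θ' x s))
        simp only [ENNReal.coe_toReal, NNReal.coe_add]
        nlinarith
    _ = 2 := by
        rw [lintegral_add_left (measurable_dens_right M θ x).coe_nnreal_ennreal,
          M.lintegral_dens, M.lintegral_dens, one_add_one_eq_two]

/-- The exponential bound for one transition. -/
theorem lintegral_dens_mul_exp_score_le (M : Model Θ S A) (θ θ₀ θ₁ : Θ) (x : S × A) :
    ∫⁻ s, M.dens θ x s * ENNReal.ofReal (Real.exp (-M.score θ₀ θ₁ x s / 8)) ∂M.base +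
        ENNReal.ofReal (1 / 128) * M.hellingerSq θ₀ θ₁ x ≤
      1 + 9 * M.hellingerSq θ θ₁ x := by
  have hd := fun θ => (measurable_dens_right M θ x)
  have hr : ∀ θ, Measurable fun s => √(M.dens θ x s : ℝ) := fun θ => (hd θ).coe_nnreal_real.sqrt
  have hsc : Measurable fun s => M.score θ₀ θ₁ x s :=
    (measurable_score M θ₀ θ₁).comp measurable_prodMk_left
  have he : Measurable fun s => ENNReal.ofReal (Real.exp (-M.score θ₀ θ₁ x s / 8)) := by fun_prop
  have hh : ∀ θ θ', Measurable fun s =>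
      ENNReal.ofReal ((√(M.dens θ x s : ℝ) - √(M.dens θ' x s : ℝ)) ^ 2) := fun θ θ' =>
    ENNReal.measurable_ofReal.comp (((hr θ).sub (hr θ')).pow_const 2)
  have key : ∀ s, M.dens θ x s * ENNReal.ofReal (Real.exp (-M.score θ₀ θ₁ x s / 8)) +
      (ENNReal.ofReal (1 / 128) *
        ENNReal.ofReal ((√(M.dens θ₀ x s : ℝ) - √(M.dens θ₁ x s : ℝ)) ^ 2) +
      ENNReal.ofReal (1 / 32) * M.dens θ₁ x s) ≤
      M.dens θ x s + (9 * ENNReal.ofReal ((√(M.dens θ x s : ℝ) - √(M.dens θ₁ x s : ℝ)) ^ 2) +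
      ENNReal.ofReal (1 / 32) * M.dens θ₀ x s) := by
    intro s
    have h := sq_mul_exp_score_le (c := √(M.dens θ x s : ℝ)) (Real.sqrt_nonneg (M.dens θ₀ x s))
      (Real.sqrt_nonneg (M.dens θ₁ x s))
    simp only [Real.sq_sqrt (NNReal.coe_nonneg _)] at h
    have e9 : (9 : ℝ≥0∞) = ENNReal.ofReal 9 := by simp
    simp only [← ENNReal.ofReal_coe_nnreal, e9]
    rw [← ENNReal.ofReal_mul (by positivity), ← ENNReal.ofReal_mul (by positivity),
      ← ENNReal.ofReal_mul (by positivity), ← ENNReal.ofReal_mul (by positivity),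
      ← ENNReal.ofReal_mul (by positivity),
      ← ENNReal.ofReal_add (by positivity) (by positivity),
      ← ENNReal.ofReal_add (by positivity) (by positivity),
      ← ENNReal.ofReal_add (by positivity) (by positivity),
      ← ENNReal.ofReal_add (by positivity) (by positivity)]
    refine ENNReal.ofReal_le_ofReal ?_
    simp only [Model.score]
    linarith
  have h := lintegral_mono (μ := M.base) key
  have hde : Measurable fun s =>
      (M.dens θ x s : ℝ≥0∞) * ENNReal.ofReal (Real.exp (-M.score θ₀ θ₁ x s / 8)) :=
    (hd θ).coe_nnreal_ennreal.mul he
  rw [lintegral_add_left hde,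
    lintegral_add_left ((hh θ₀ θ₁).const_mul _), lintegral_const_mul _ (hh θ₀ θ₁),
    lintegral_const_mul _ (hd θ₁).coe_nnreal_ennreal,
    lintegral_add_left (hd θ).coe_nnreal_ennreal,
    lintegral_add_left ((hh θ θ₁).const_mul _), lintegral_const_mul _ (hh θ θ₁),
    lintegral_const_mul _ (hd θ₀).coe_nnreal_ennreal, M.lintegral_dens, M.lintegral_dens,
    M.lintegral_dens, ← add_assoc, ← add_assoc, mul_one] at h
  -- The two 1/32 terms cancel because both densities integrate to 1; this is their only role.
  exact (ENNReal.add_le_add_iff_right ENNReal.ofReal_ne_top).1 h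

/-! ### Conditioning on the past and the two halves of Assumption A4 -/

/-- The state-action pair `(S_t, A_t)` of a trajectory. -/
def pairAt {S A : Type*} (t : ℕ) (ω : Traj S A) : S × A := ((ω t).1, (ω t).2.1)

theorem measurable_pairAt (t : ℕ) : Measurable (pairAt (S := S) (A := A) t) := by
  unfold pairAt; fun_prop

theorem dependsOn_exists_extHist {F : Traj S A → ℝ≥0∞} (hF : Measurable F) {i : ℕ}
    (hd : DependsOn F (Set.Iic i)) :
    ∃ f : ExtHist S A i → ℝ≥0∞, Measurable f ∧ ∀ ω, F ω = f (extHist i ω) := by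
  -- A history is extended to a trajectory by freezing it at time i; F cannot see the difference.
  have hm : Measurable fun (h : ExtHist S A i) (n : ℕ) =>
      h ⟨min n i, Finset.mem_Iic.2 (min_le_right _ _)⟩ := by fun_prop
  refine ⟨_, hF.comp hm, fun ω => hd fun n hn => ?_⟩
  simp [extHist, min_eq_left (Set.mem_Iic.1 hn)]

/-- Given H̃_i, the factor F is constant and S_{i+1} has density p_θ(·|S_i, A_i). -/
theorem lintegral_mul_transition (M : Model Θ S A) (π : Policy S A) (ι : Measure S)
    [IsProbabilityMeasure ι] (θ : Θ) (i : ℕ) {F : Traj S A → ℝ≥0∞} (hF : Measurable F)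
    (hd : DependsOn F (Set.Iic i)) {e : (S × A) × S → ℝ≥0∞} (he : Measurable e) :
    ∫⁻ ω, F ω * e (pairAt i ω, (ω (i + 1)).1) ∂(M.law π ι θ) =
      ∫⁻ ω, F ω * ∫⁻ s, M.dens θ (pairAt i ω) s * e (pairAt i ω, s) ∂M.base ∂(M.law π ι θ) := by
  obtain ⟨f, hf, hfF⟩ := dependsOn_exists_extHist hF hd
  have hl := measurable_lastPair (S := S) (A := A) i
  have hg : Measurable fun p : ExtHist S A i × Step S A => f p.1 * e (lastPair i p.1, p.2.1) :=
    (hf.comp measurable_fst).mul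
      (he.comp ((hl.comp measurable_fst).prodMk (measurable_fst.comp measurable_snd)))
  have h1 := lintegral_map (μ := M.law π ι θ) hg
    ((measurable_extHist i).prodMk (measurable_pi_apply (i + 1)))
  rw [map_extHist_next_law, Measure.lintegral_compProd hg] at h1
  have h2 : ∀ h : ExtHist S A i,
      ∫⁻ y, f h * e (lastPair i h, y.1) ∂(M.stepKernel π θ i h) =
        f h * ∫⁻ s, M.dens θ (lastPair i h) s * e (lastPair i h, s) ∂M.base := by
    intro h
    have hsx : Measurable fun y : Step S A => e (lastPair i h, y.1) :=
      he.comp (measurable_const.prodMk measurable_fst)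
    rw [lintegral_const_mul _ hsx, lintegral_stepKernel M π θ i h hsx]
    simp [Model.addReward]
  have hm : Measurable fun h : ExtHist S A i =>
      f h * ∫⁻ s, M.dens θ (lastPair i h) s * e (lastPair i h, s) ∂M.base := by
    refine hf.mul (Measurable.lintegral_prod_right' (ν := M.base)
      (f := fun q : ExtHist S A i × S => M.dens θ (lastPair i q.1) q.2 * e (lastPair i q.1, q.2)) ?_)
    exact (measurable_dens_comp M measurable_const (hl.comp measurable_fst)
      measurable_snd).coe_nnreal_ennreal.mul
      (he.comp ((hl.comp measurable_fst).prodMk measurable_snd))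
  simp only [h2] at h1
  rw [lintegral_map hm (measurable_extHist i)] at h1
  simp only [hfF]
  exact h1.symm

theorem lintegral_mul_exp_score_le (M : Model Θ S A) (π : Policy S A) (ι : Measure S)
    [IsProbabilityMeasure ι] (θ θ₀ θ₁ : Θ) (i : ℕ) {F : Traj S A → ℝ≥0∞} (hF : Measurable F)
    (hd : DependsOn F (Set.Iic i)) :
    ∫⁻ ω, F ω * ENNReal.ofReal (Real.exp (-M.score θ₀ θ₁ (pairAt i ω) (ω (i + 1)).1 / 8))
        ∂(M.law π ι θ) +
      ENNReal.ofReal (1 / 128) * ∫⁻ ω, F ω * M.hellingerSq θ₀ θ₁ (pairAt i ω) ∂(M.law π ι θ) ≤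
    ∫⁻ ω, F ω ∂(M.law π ι θ) +
      9 * ∫⁻ ω, F ω * M.hellingerSq θ θ₁ (pairAt i ω) ∂(M.law π ι θ) := by
  have hs : Measurable fun p : (S × A) × S =>
      ENNReal.ofReal (Real.exp (-M.score θ₀ θ₁ p.1 p.2 / 8)) := by
    have := measurable_score M θ₀ θ₁
    fun_prop
  have hh : ∀ θ θ', Measurable fun ω => F ω * M.hellingerSq θ θ' (pairAt i ω) := fun θ θ' =>
    hF.mul ((measurable_hellingerSq_right M θ θ').comp (measurable_pairAt i))
  rw [lintegral_mul_transition M π ι θ i hF hd hs, ← lintegral_const_mul _ (hh θ₀ θ₁),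
    ← lintegral_const_mul _ (hh θ θ₁), ← lintegral_add_right _ ((hh θ₀ θ₁).const_mul _),
    ← lintegral_add_left hF]
  refine lintegral_mono fun ω => ?_
  have h := mul_le_mul' (le_refl (F ω)) (lintegral_dens_mul_exp_score_le M θ θ₀ θ₁ (pairAt i ω))
  rw [mul_add, mul_add, mul_one] at h
  simpa only [mul_left_comm, mul_comm] using h

/-- Averages over the conditional law of `(S_{i+j}, A_{i+j})` given `H̃_i`. -/
theorem lintegral_mul_pairAt (M : Model Θ S A) (π : Policy S A) (ι : Measure S)
    [IsProbabilityMeasure ι] (θ : Θ) (i j : ℕ) {f : ExtHist S A i → ℝ≥0∞} (hf : Measurable f)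
    {g : S × A → ℝ≥0∞} (hg : Measurable g) :
    ∫⁻ ω, f (extHist i ω) * g (pairAt (i + j) ω) ∂(M.law π ι θ) =
      ∫⁻ h, f h * ∫⁻ x, g x ∂(M.condPairLaw π θ i j h) ∂((M.law π ι θ).map (extHist i)) := by
  have hp := measurable_pairAt (S := S) (A := A) (i + j)
  have hgp : Measurable fun ω : Traj S A => g (pairAt (i + j) ω) := hg.comp hp
  have hm : Measurable fun p : ExtHist S A i × Traj S A => f p.1 * g (pairAt (i + j) p.2) :=
    (hf.comp measurable_fst).mul (hgp.comp measurable_snd)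
  rw [lintegral_extHist_law M π ι θ i hm]
  refine lintegral_congr fun h => ?_
  dsimp only
  rw [lintegral_const_mul _ hgp]
  congr 1
  exact (lintegral_map hg hp).symm

/-- Conditionally on H̃_i the law of the pair l steps later is dominated by ν dλ whatever the past,
so the weight F factors out. -/
theorem lintegral_mul_pairAt_le (M : Model Θ S A) (lam : Measure (S × A)) (π : Policy S A)
    (ι : Measure S) [IsProbabilityMeasure ι] {k l : ℕ} {α : ℕ → ℝ} {μ ν : S × A → ℝ≥0}
    (hν : Measurable ν) (hU : UniformBounds M lam π ι k l α μ ν) (θ : Θ) {i : ℕ}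
    {F : Traj S A → ℝ≥0∞} (hF : Measurable F) (hd : DependsOn F (Set.Iic i))
    {g : S × A → ℝ≥0∞} (hg : Measurable g) :
    ∫⁻ ω, F ω * g (pairAt (i + l) ω) ∂(M.law π ι θ) ≤
      (∫⁻ x, g x * ν x ∂lam) * ∫⁻ ω, F ω ∂(M.law π ι θ) := by
  obtain ⟨f, hf, hfF⟩ := dependsOn_exists_extHist hF hd
  simp only [hfF]
  rw [lintegral_mul_pairAt M π ι θ i l hf hg, mul_comm (∫⁻ x, g x * ν x ∂lam),
    ← lintegral_map (f := f) hf (measurable_extHist i), ← lintegral_mul_const _ hf]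
  refine lintegral_mono_ae ?_
  filter_upwards [hU.upper θ i] with h hh
  refine mul_le_mul' le_rfl ((lintegral_mono' hh le_rfl).trans_eq ?_)
  rw [lintegral_withDensity_eq_lintegral_mul _ hν.coe_nnreal_ennreal hg]
  simp [mul_comm]

/-- The counterpart for the lower half of A4. A lower bound is available only for the average over k
successive times, which is why the tests work with block averages. -/
theorem le_sum_lintegral_mul_pairAt (M : Model Θ S A) (lam : Measure (S × A)) (π : Policy S A)
    (ι : Measure S) [IsProbabilityMeasure ι] {k l : ℕ} {α : ℕ → ℝ} {μ ν : S × A → ℝ≥0}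
    (hμ : Measurable μ) (hU : UniformBounds M lam π ι k l α μ ν) (θ : Θ) {i : ℕ}
    {F : Traj S A → ℝ≥0∞} (hF : Measurable F) (hd : DependsOn F (Set.Iic i))
    {g : S × A → ℝ≥0∞} (hg : Measurable g) :
    ENNReal.ofReal (α i) * (∫⁻ x, g x * μ x ∂lam) * ∫⁻ ω, F ω ∂(M.law π ι θ) ≤
      (k : ℝ≥0∞)⁻¹ * ∑ j ∈ Finset.Icc 1 k, ∫⁻ ω, F ω * g (pairAt (i + j) ω) ∂(M.law π ι θ) := by
  obtain ⟨f, hf, hfF⟩ := dependsOn_exists_extHist hF hd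
  simp only [hfF]
  have hm : ∀ j, Measurable fun h => f h * ∫⁻ x, g x ∂(M.condPairLaw π θ i j h) := by
    intro j
    refine hf.mul ?_
    have : ∀ h, ∫⁻ x, g x ∂(M.condPairLaw π θ i j h) =
        ∫⁻ ω, g (pairAt (i + j) ω) ∂(M.trajFrom π θ i h) := fun h =>
      lintegral_map hg (measurable_pairAt (i + j))
    simp only [this]
    exact (hg.comp (measurable_pairAt (i + j))).lintegral_kernel
  simp only [lintegral_mul_pairAt M π ι θ i _ hf hg]
  rw [← lintegral_finsetSum _ fun j _ => hm j,
    ← lintegral_const_mul _ (Finset.measurable_fun_sum _ fun j _ => hm j),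
    ← lintegral_map (f := f) hf (measurable_extHist i), ← lintegral_const_mul _ hf]
  refine lintegral_mono_ae ?_
  filter_upwards [hU.lower θ i] with h hh
  have h1 := lintegral_mono' hh (le_refl g)
  rw [lintegral_smul_measure, lintegral_smul_measure, lintegral_finsetSum_measure,
    lintegral_withDensity_eq_lintegral_mul _ hμ.coe_nnreal_ennreal hg] at h1
  simp only [smul_eq_mul, Pi.mul_apply] at h1
  rw [← Finset.mul_sum, mul_comm _ (f h), mul_left_comm (k : ℝ≥0∞)⁻¹]
  refine mul_le_mul' le_rfl ?_
  simpa only [mul_comm (g _)] using h1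

/-! ### Block scores and their exponential moments -/

/-- The average score of the transitions at the times `b + 1, …, b + k`. -/
def Model.blockScore (M : Model Θ S A) (θ₀ θ₁ : Θ) (k b : ℕ) (ω : Traj S A) : ℝ :=
  (∑ j ∈ Finset.Icc 1 k, M.score θ₀ θ₁ (pairAt (b + j) ω) (ω (b + j + 1)).1) / k

theorem measurable_score_pairAt (M : Model Θ S A) (θ₀ θ₁ : Θ) (i : ℕ) :
    Measurable fun ω : Traj S A => M.score θ₀ θ₁ (pairAt i ω) (ω (i + 1)).1 :=
  (measurable_score M θ₀ θ₁).comp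
    ((measurable_pairAt i).prodMk (measurable_pi_apply (i + 1)).fst)

theorem measurable_blockScore (M : Model Θ S A) (θ₀ θ₁ : Θ) (k b : ℕ) :
    Measurable (M.blockScore θ₀ θ₁ k b) :=
  (Finset.measurable_fun_sum _ fun j _ => measurable_score_pairAt M θ₀ θ₁ (b + j)).div_const _

/-- The last transition reads only the state at time b + k + 1, not the action taken there. Tracking
this lets the test be a function of H_t, which ends in S_t. -/
theorem blockScore_congr (M : Model Θ S A) (θ₀ θ₁ : Θ) (k b : ℕ) {ω ω' : Traj S A}
    (h : ∀ i < b + k + 1, ω i = ω' i) (h' : (ω (b + k + 1)).1 = (ω' (b + k + 1)).1) :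
    M.blockScore θ₀ θ₁ k b ω = M.blockScore θ₀ θ₁ k b ω' := by
  unfold Model.blockScore
  congr 1
  refine Finset.sum_congr rfl fun j hj => ?_
  have hj' := Finset.mem_Icc.1 hj
  rw [pairAt, pairAt, h (b + j) (by omega)]
  congr 1
  rcases hj'.2.eq_or_lt with rfl | hlt
  · exact h'
  · rw [h _ (by omega)]

theorem blockScore_swap (M : Model Θ S A) (θ₀ θ₁ : Θ) (k b : ℕ) (ω : Traj S A) :
    M.blockScore θ₁ θ₀ k b ω = -M.blockScore θ₀ θ₁ k b ω := by
  simp only [Model.blockScore, score_swap M θ₀ θ₁, Finset.sum_neg_distrib, neg_div]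

/-- Jensen's inequality. It replaces the exponential of a block average by an average of
one-transition exponentials, so no independence within the block is needed. -/
theorem exp_average_le {k : ℕ} (hk : 0 < k) (f : ℕ → ℝ) :
    ENNReal.ofReal (Real.exp (-((∑ j ∈ Finset.Icc 1 k, f j) / k) / 8)) ≤
      (k : ℝ≥0∞)⁻¹ * ∑ j ∈ Finset.Icc 1 k, ENNReal.ofReal (Real.exp (-f j / 8)) := by
  have hk' : (0 : ℝ) < k := Nat.cast_pos.2 hk
  have h := convexOn_exp.map_sum_le (t := Finset.Icc 1 k) (w := fun _ => (k : ℝ)⁻¹)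
    (p := fun j => -f j / 8) (fun _ _ => by positivity) (by simp [hk'.ne']) (fun _ _ => trivial)
  rw [← ENNReal.ofReal_sum_of_nonneg fun _ _ => (Real.exp_pos _).le, ← ENNReal.ofReal_natCast,
    ← ENNReal.ofReal_inv_of_pos hk', ← ENNReal.ofReal_mul (by positivity)]
  refine ENNReal.ofReal_le_ofReal ?_
  simp only [smul_eq_mul, ← Finset.mul_sum] at h
  refine le_trans (le_of_eq ?_) h
  rw [← Finset.sum_div, Finset.sum_neg_distrib]
  congr 1
  field_simp

/-- The weight F carries the earlier blocks. The lower half of A4 is applied at time b, hence s ≤ b.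
The upper half is applied l steps before each transition, at times b + j − l, and s + l ≤ b + 1 says
that the earliest of these is not before s. -/
theorem lintegral_mul_exp_blockScore_le (M : Model Θ S A) (lam : Measure (S × A)) (π : Policy S A)
    (ι : Measure S) [IsProbabilityMeasure ι] {k l : ℕ} (hk : 0 < k) {α : ℕ → ℝ}
    {μ ν : S × A → ℝ≥0} (hμ : Measurable μ) (hν : Measurable ν)
    (hU : UniformBounds M lam π ι k l α μ ν) (θ θ₀ θ₁ : Θ) {s b : ℕ} (hsb : s ≤ b)
    (hbs : s + l ≤ b + 1) {F : Traj S A → ℝ≥0∞} (hF : Measurable F)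
    (hd : DependsOn F (Set.Iic s)) :
    ∫⁻ ω, F ω * ENNReal.ofReal (Real.exp (-M.blockScore θ₀ θ₁ k b ω / 8)) ∂(M.law π ι θ) +
      ENNReal.ofReal (1 / 128) * (ENNReal.ofReal (α b) *
        (∫⁻ x, M.hellingerSq θ₀ θ₁ x * μ x ∂lam) * ∫⁻ ω, F ω ∂(M.law π ι θ)) ≤
    ∫⁻ ω, F ω ∂(M.law π ι θ) +
      9 * ((∫⁻ x, M.hellingerSq θ θ₁ x * ν x ∂lam) * ∫⁻ ω, F ω ∂(M.law π ι θ)) := by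
  have hdep : ∀ {n}, s ≤ n → DependsOn F (Set.Iic n) := fun h => hd.mono (Set.Iic_subset_Iic.2 h)
  have hm : ∀ j, Measurable fun ω : Traj S A => F ω *
      ENNReal.ofReal (Real.exp (-M.score θ₀ θ₁ (pairAt (b + j) ω) (ω (b + j + 1)).1 / 8)) := by
    intro j
    have := measurable_score_pairAt M θ₀ θ₁ (b + j)
    fun_prop
  have hk0 : (k : ℝ≥0∞) ≠ 0 := Nat.cast_ne_zero.2 hk.ne'
  have h1 : ∫⁻ ω, F ω * ENNReal.ofReal (Real.exp (-M.blockScore θ₀ θ₁ k b ω / 8)) ∂(M.law π ι θ) ≤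
      (k : ℝ≥0∞)⁻¹ * ∑ j ∈ Finset.Icc 1 k, ∫⁻ ω, F ω *
        ENNReal.ofReal (Real.exp (-M.score θ₀ θ₁ (pairAt (b + j) ω) (ω (b + j + 1)).1 / 8))
        ∂(M.law π ι θ) := by
    rw [← lintegral_finsetSum _ fun j _ => hm j,
      ← lintegral_const_mul _ (Finset.measurable_fun_sum _ fun j _ => hm j)]
    refine lintegral_mono fun ω => ?_
    rw [← Finset.mul_sum, mul_left_comm]
    exact mul_le_mul' le_rfl (exp_average_le hk fun j =>
      M.score θ₀ θ₁ (pairAt (b + j) ω) (ω (b + j + 1)).1)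
  have h2 := le_sum_lintegral_mul_pairAt M lam π ι hμ hU θ hF (hdep hsb)
    (measurable_hellingerSq_right M θ₀ θ₁)
  have h3 : ∀ j ∈ Finset.Icc 1 k,
      ∫⁻ ω, F ω *
        ENNReal.ofReal (Real.exp (-M.score θ₀ θ₁ (pairAt (b + j) ω) (ω (b + j + 1)).1 / 8))
        ∂(M.law π ι θ) +
      ENNReal.ofReal (1 / 128) * ∫⁻ ω, F ω * M.hellingerSq θ₀ θ₁ (pairAt (b + j) ω)
        ∂(M.law π ι θ) ≤
      ∫⁻ ω, F ω ∂(M.law π ι θ) +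
        9 * ((∫⁻ x, M.hellingerSq θ θ₁ x * ν x ∂lam) * ∫⁻ ω, F ω ∂(M.law π ι θ)) := by
    intro j hj
    have hj' := Finset.mem_Icc.1 hj
    refine (lintegral_mul_exp_score_le M π ι θ θ₀ θ₁ (b + j) hF (hdep (by omega))).trans ?_
    -- The natural subtraction is not truncated, since l ≤ b + 1 ≤ b + j.
    have h4 := lintegral_mul_pairAt_le M lam π ι hν hU θ (i := b + j - l) hF (hdep (by omega))
      (measurable_hellingerSq_right M θ θ₁)
    rw [show b + j - l + l = b + j by omega] at h4
    gcongr
  have h5 := Finset.sum_le_sum h3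
  rw [Finset.sum_add_distrib, ← Finset.mul_sum, Finset.sum_const, Nat.card_Icc,
    Nat.add_sub_cancel, nsmul_eq_mul] at h5
  calc _ ≤ (k : ℝ≥0∞)⁻¹ * (∑ j ∈ Finset.Icc 1 k, ∫⁻ ω, F ω *
        ENNReal.ofReal (Real.exp (-M.score θ₀ θ₁ (pairAt (b + j) ω) (ω (b + j + 1)).1 / 8))
        ∂(M.law π ι θ)) + ENNReal.ofReal (1 / 128) * ((k : ℝ≥0∞)⁻¹ * ∑ j ∈ Finset.Icc 1 k,
          ∫⁻ ω, F ω * M.hellingerSq θ₀ θ₁ (pairAt (b + j) ω) ∂(M.law π ι θ)) := by gcongr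
    _ ≤ (k : ℝ≥0∞)⁻¹ * (k * _) := by
      rw [mul_left_comm, ← mul_add]
      exact mul_le_mul' le_rfl h5
    _ = _ := ENNReal.inv_mul_cancel_left hk0 (ENNReal.natCast_ne_top k)

/-- The sum of the block scores over the blocks `1, …, n`. -/
def Model.totalScore (M : Model Θ S A) (θ₀ θ₁ : Θ) (k l n : ℕ) (ω : Traj S A) : ℝ :=
  ∑ i ∈ Finset.range n, M.blockScore θ₀ θ₁ k ((i + 1) * (k + l)) ω

theorem measurable_totalScore (M : Model Θ S A) (θ₀ θ₁ : Θ) (k l n : ℕ) :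
    Measurable (M.totalScore θ₀ θ₁ k l n) :=
  Finset.measurable_fun_sum _ fun _ _ => measurable_blockScore M θ₀ θ₁ k _

theorem totalScore_congr (M : Model Θ S A) (θ₀ θ₁ : Θ) {k l n t : ℕ} (ht : n * (k + l) + k + 1 ≤ t)
    {ω ω' : Traj S A} (h : ∀ i < t, ω i = ω' i) (h' : (ω t).1 = (ω' t).1) :
    M.totalScore θ₀ θ₁ k l n ω = M.totalScore θ₀ θ₁ k l n ω' := by
  refine Finset.sum_congr rfl fun i hi => ?_
  have h1 : (i + 1) * (k + l) ≤ n * (k + l) :=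
    Nat.mul_le_mul_right _ (Finset.mem_range.1 hi)
  refine blockScore_congr M θ₀ θ₁ k _ (fun j hj => h j (by omega)) ?_
  rcases (show (i + 1) * (k + l) + k + 1 ≤ t by omega).eq_or_lt with he | hlt
  · rwa [he]
  · rw [h _ hlt]

theorem totalScore_swap (M : Model Θ S A) (θ₀ θ₁ : Θ) (k l n : ℕ) (ω : Traj S A) :
    M.totalScore θ₁ θ₀ k l n ω = -M.totalScore θ₀ θ₁ k l n ω := by
  simp only [Model.totalScore, blockScore_swap M θ₀ θ₁, Finset.sum_neg_distrib]

/-- Each block multiplies the moment by at most 1 + 9 dν − α dμ/128, and 1 + y ≤ e^y. Here dμ and dν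
stand for squared distances. -/
theorem lintegral_exp_totalScore_le (M : Model Θ S A) (lam : Measure (S × A)) (π : Policy S A)
    (ι : Measure S) [IsProbabilityMeasure ι] {k l : ℕ} (hk : 0 < k) (hl : 0 < l) {α : ℕ → ℝ}
    (hα : ∀ i, 0 < α i) {μ ν : S × A → ℝ≥0} (hμ : Measurable μ) (hν : Measurable ν)
    (hU : UniformBounds M lam π ι k l α μ ν) (θ θ₀ θ₁ : Θ) {dμ dν : ℝ} (hdμ0 : 0 ≤ dμ)
    (hdν0 : 0 ≤ dν)
    (hdμ : ∫⁻ x, M.hellingerSq θ₀ θ₁ x * μ x ∂lam = ENNReal.ofReal dμ)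
    (hdν : ∫⁻ x, M.hellingerSq θ θ₁ x * ν x ∂lam = ENNReal.ofReal dν) (n : ℕ) :
    ∫⁻ ω, ENNReal.ofReal (Real.exp (-M.totalScore θ₀ θ₁ k l n ω / 8)) ∂(M.law π ι θ) ≤
      ENNReal.ofReal (Real.exp (∑ i ∈ Finset.range n,
        (9 * dν - α ((i + 1) * (k + l)) * dμ / 128))) := by
  induction n with
  | zero => simp [Model.totalScore]
  | succ n ih =>
    have hF : Measurable fun ω =>
        ENNReal.ofReal (Real.exp (-M.totalScore θ₀ θ₁ k l n ω / 8)) := by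
      have := measurable_totalScore M θ₀ θ₁ k l n
      fun_prop
    have hd : DependsOn (fun ω => ENNReal.ofReal (Real.exp (-M.totalScore θ₀ θ₁ k l n ω / 8)))
        (Set.Iic (n * (k + l) + k + 1)) := by
      intro ω ω' h
      dsimp only
      rw [totalScore_congr M θ₀ θ₁ le_rfl (fun i hi => h i hi.le) (by rw [h _ Set.self_mem_Iic])]
    have hb : (n + 1) * (k + l) = n * (k + l) + k + l := by ring
    -- The first n blocks are known at s = n(k+l) + k + 1, and the next one starts at b = s + l − 1,
    -- so the gap of l is exactly what is required.
    have h := lintegral_mul_exp_blockScore_le M lam π ι hk hμ hν hU θ θ₀ θ₁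
      (b := (n + 1) * (k + l)) (by omega) (by omega) hF hd
    obtain ⟨E, hE⟩ : ∃ E, E =
      ∫⁻ ω, ENNReal.ofReal (Real.exp (-M.totalScore θ₀ θ₁ k l n ω / 8)) ∂(M.law π ι θ) := ⟨_, rfl⟩
    have e1 : ∀ ω, ENNReal.ofReal (Real.exp (-M.totalScore θ₀ θ₁ k l (n + 1) ω / 8)) =
        ENNReal.ofReal (Real.exp (-M.totalScore θ₀ θ₁ k l n ω / 8)) *
        ENNReal.ofReal (Real.exp (-M.blockScore θ₀ θ₁ k ((n + 1) * (k + l)) ω / 8)) := by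
      intro ω
      rw [← ENNReal.ofReal_mul (Real.exp_pos _).le, ← Real.exp_add, Model.totalScore,
        Finset.sum_range_succ, Model.totalScore]
      congr 2
      ring
    rw [lintegral_congr e1]
    rw [← hE] at h ih
    have hEt : E ≠ ∞ := ne_top_of_le_ne_top ENNReal.ofReal_ne_top ih
    obtain ⟨e, he0, rfl⟩ : ∃ e : ℝ, 0 ≤ e ∧ E = ENNReal.ofReal e :=
      ⟨E.toReal, ENNReal.toReal_nonneg, (ENNReal.ofReal_toReal hEt).symm⟩
    have hαn := hα ((n + 1) * (k + l))
    rw [hdμ, hdν, show (9 : ℝ≥0∞) = ENNReal.ofReal 9 by simp,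
      ← ENNReal.ofReal_mul hαn.le, ← ENNReal.ofReal_mul (by positivity),
      ← ENNReal.ofReal_mul (by positivity), ← ENNReal.ofReal_mul (by positivity),
      ← ENNReal.ofReal_mul (by positivity), ← ENNReal.ofReal_add he0 (by positivity)] at h
    have h' := ENNReal.le_sub_of_add_le_right ENNReal.ofReal_ne_top h
    rw [← ENNReal.ofReal_sub _ (by positivity)] at h'
    refine h'.trans (ENNReal.ofReal_le_ofReal ?_)
    have ih' := (ENNReal.ofReal_le_ofReal_iff (Real.exp_pos _).le).1 ih
    rw [Finset.sum_range_succ, Real.exp_add]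
    calc _ = e * (9 * dν - α ((n + 1) * (k + l)) * dμ / 128 + 1) := by ring
      _ ≤ e * Real.exp (9 * dν - α ((n + 1) * (k + l)) * dμ / 128) :=
        mul_le_mul_of_nonneg_left (Real.add_one_le_exp _) he0
      _ ≤ _ := mul_le_mul_of_nonneg_right ih' (Real.exp_pos _).le

/-! ### Boundedness of d_μ and construction of the tests -/

theorem dist_sq (M : Model Θ S A) (lam : Measure (S × A)) (μ : S × A → ℝ≥0) (θ θ' : Θ) :
    M.dist lam μ θ θ' ^ 2 = ∫⁻ x, M.hellingerSq θ θ' x * μ x ∂lam := by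
  rw [Model.dist, ← ENNReal.rpow_natCast, ← ENNReal.rpow_mul]
  norm_num

theorem dist_comm (M : Model Θ S A) (lam : Measure (S × A)) (μ : S × A → ℝ≥0) (θ θ' : Θ) :
    M.dist lam μ θ θ' = M.dist lam μ θ' θ := by
  simp only [Model.dist, hellingerSq_comm M θ θ']

/-- The lower half of A4 with weight 1, together with h² ≤ 2. Besides finiteness of d_μ, it shows
that a single block contributes at most a constant to the exponent, so one block may be dropped. -/
theorem ofReal_mul_dist_sq_le (M : Model Θ S A) (lam : Measure (S × A)) (π : Policy S A)
    (ι : Measure S) [IsProbabilityMeasure ι] {k l : ℕ} {α : ℕ → ℝ} {μ ν : S × A → ℝ≥0}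
    (hμ : Measurable μ) (hU : UniformBounds M lam π ι k l α μ ν) (i : ℕ) (θ θ' : Θ) :
    ENNReal.ofReal (α i) * M.dist lam μ θ θ' ^ 2 ≤ 2 := by
  have h := le_sum_lintegral_mul_pairAt M lam π ι hμ hU θ (i := i) (F := fun _ => 1)
    measurable_const (dependsOn_const _ |>.mono (Set.empty_subset _))
    (measurable_hellingerSq_right M θ θ')
  rw [lintegral_one, measure_univ, mul_one, ← dist_sq] at h
  refine h.trans ?_
  calc _ ≤ (k : ℝ≥0∞)⁻¹ * ∑ j ∈ Finset.Icc 1 k, 2 := by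
        gcongr with j
        refine (lintegral_mono fun ω => (one_mul _).le.trans (hellingerSq_le_two M θ θ' _)).trans ?_
        simp
    _ = (k : ℝ≥0∞)⁻¹ * k * 2 := by simp [mul_assoc]
    _ ≤ 1 * 2 := mul_le_mul' (ENNReal.inv_mul_le_one _) le_rfl
    _ = 2 := one_mul 2

theorem dist_ne_top (M : Model Θ S A) (lam : Measure (S × A)) (π : Policy S A)
    (ι : Measure S) [IsProbabilityMeasure ι] {k l : ℕ} {α : ℕ → ℝ} (hα : ∀ i, 0 < α i)
    {μ ν : S × A → ℝ≥0} (hμ : Measurable μ) (hU : UniformBounds M lam π ι k l α μ ν) (θ θ' : Θ) :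
    M.dist lam μ θ θ' ≠ ∞ := by
  intro h
  have := ofReal_mul_dist_sq_le M lam π ι hμ hU 0 θ θ'
  rw [h, ENNReal.top_pow two_ne_zero, ENNReal.mul_top (by simpa using hα 0)] at this
  simp at this

theorem integral_le_of_lintegral_le {X : Type*} [MeasurableSpace X] {P : Measure X} {f g : X → ℝ}
    {B : ℝ} (hB : 0 ≤ B) (hf : Measurable f) (hf0 : ∀ x, 0 ≤ f x) (hfg : ∀ x, f x ≤ g x)
    (h : ∫⁻ x, ENNReal.ofReal (g x) ∂P ≤ ENNReal.ofReal B) : ∫ x, f x ∂P ≤ B := by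
  rw [integral_eq_lintegral_of_nonneg_ae (ae_of_all _ hf0) hf.aestronglyMeasurable]
  refine ENNReal.toReal_le_of_le_ofReal hB (le_trans (lintegral_mono fun x => ?_) h)
  exact ENNReal.ofReal_le_ofReal (hfg x)

/-- A trajectory that starts with a given history. -/
def embedHist {S A : Type*} {t : ℕ} (ht : 0 < t) (h : Hist S A t) : Traj S A := fun i =>
  -- The action and reward after time t − 1 are fillers copied from step 0, so t must be positive;
  -- only the state at time t is ever read.
  if hi : i < t then h.1 ⟨i, hi⟩ else (h.2, (h.1 ⟨0, ht⟩).2)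

theorem measurable_embedHist {t : ℕ} (ht : 0 < t) :
    Measurable (embedHist (S := S) (A := A) ht) := by
  refine measurable_pi_lambda _ fun i => ?_
  unfold embedHist
  split_ifs <;> fun_prop

theorem totalScore_embedHist (M : Model Θ S A) (θ₀ θ₁ : Θ) {k l n t : ℕ} (ht0 : 0 < t)
    (ht : n * (k + l) + k + 1 ≤ t) (ω : Traj S A) :
    M.totalScore θ₀ θ₁ k l n (embedHist ht0 (hist t ω)) = M.totalScore θ₀ θ₁ k l n ω := by
  refine totalScore_congr M θ₀ θ₁ ht (fun i hi => ?_) ?_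
  · simp [embedHist, hist, hi]
  · simp [embedHist, hist]

/-- The testing part of the theorem, with explicit constants. -/
theorem hasTests (M : Model Θ S A) (lam : Measure (S × A)) (π : Policy S A)
    (ι : Measure S) [IsProbabilityMeasure ι] {k l : ℕ} (hk : 0 < k) (hl : 0 < l) {α : ℕ → ℝ}
    (hα : ∀ i, 0 < α i) (hanti : Antitone α) {μ ν : S × A → ℝ≥0} (hμ : Measurable μ)
    (hν : Measurable ν) (hU : UniformBounds M lam π ι k l α μ ν) :
    HasTests M lam π ι k l α μ ν (1 / 512) (1 / 48) := by
  intro θ₀ θ₁ t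
  have hdt := dist_ne_top M lam π ι hα hμ hU θ₀ θ₁
  obtain ⟨d, hd⟩ : ∃ d, d = (M.dist lam μ θ₀ θ₁).toReal := ⟨_, rfl⟩
  have hd0 : 0 ≤ d := hd ▸ ENNReal.toReal_nonneg
  have hdd : M.dist lam μ θ₀ θ₁ = ENNReal.ofReal d := by rw [hd, ENNReal.ofReal_toReal hdt]
  have hDμ : ∫⁻ x, M.hellingerSq θ₀ θ₁ x * μ x ∂lam = ENNReal.ofReal (d ^ 2) := by
    rw [← dist_sq, hdd, ENNReal.ofReal_pow hd0]
  obtain ⟨B, hB⟩ : ∃ B, B = Real.exp (-(1 / 512) * alphaSum k l α t * d ^ 2) := ⟨_, rfl⟩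
  have hBpos : 0 < B := hB ▸ Real.exp_pos _
  rw [← hd, ← hB]
  -- If the exponent is bounded, the constant test 1/2 is good enough. Otherwise the threshold 4,
  -- against α 0 · d² ≤ 2, shows that discarding block 0 loses at most half of the sum.
  by_cases hsmall : alphaSum k l α t * d ^ 2 ≤ 4
  · have hB2 : 1 / 2 ≤ B := by
      have := Real.add_one_le_exp (-(1 / 512) * alphaSum k l α t * d ^ 2)
      rw [hB]
      linarith
    refine ⟨fun _ => 1 / 2, measurable_const, fun _ => by norm_num, by simpa using hB2,
      fun θ _ => ?_⟩
    norm_num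
    linarith
  push Not at hsmall
  obtain ⟨n, hn⟩ : ∃ n, t / (k + l) = n + 1 := by
    refine ⟨t / (k + l) - 1, (Nat.sub_add_cancel (Nat.pos_of_ne_zero fun h0 => ?_)).symm⟩
    rw [alphaSum, h0] at hsmall
    simp at hsmall
    linarith
  have hnt : (n + 1) * (k + l) ≤ t := hn ▸ Nat.div_mul_le_self t (k + l)
  have hnt' : n * (k + l) + k + 1 ≤ t := by
    have : (n + 1) * (k + l) = n * (k + l) + k + l := by ring
    omega
  have ht0 : 0 < t := by omega
  -- Block 0 is left out: the upper half of A4 says nothing about pairs at times before l.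
  obtain ⟨s, hs⟩ : ∃ s, s = ∑ i ∈ Finset.range n, α ((i + 1) * (k + l)) := ⟨_, rfl⟩
  have hsum : alphaSum k l α t = s + α 0 := by
    rw [alphaSum, hn, Finset.sum_range_succ', hs, zero_mul]
  have hα0 : α 0 * d ^ 2 ≤ 2 := by
    have h := ofReal_mul_dist_sq_le M lam π ι hμ hU 0 θ₀ θ₁
    rw [hdd, ← ENNReal.ofReal_pow hd0, ← ENNReal.ofReal_mul (hα 0).le] at h
    exact (ENNReal.ofReal_le_ofReal_iff (by norm_num)).1 (by simpa using h)
  have hs2 : alphaSum k l α t * d ^ 2 ≤ 2 * (s * d ^ 2) := by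
    rw [hsum] at hsmall ⊢
    linarith
  have hT : Measurable fun h => M.totalScore θ₀ θ₁ k l n (embedHist ht0 h) :=
    (measurable_totalScore M θ₀ θ₁ k l n).comp (measurable_embedHist ht0)
  have hset : MeasurableSet {h | 0 ≤ M.totalScore θ₀ θ₁ k l n (embedHist (A := A) ht0 h)} :=
    measurableSet_le measurable_const hT
  classical
  have hφ : Measurable fun h : Hist S A t =>
      if 0 ≤ M.totalScore θ₀ θ₁ k l n (embedHist ht0 h) then (1 : ℝ) else 0 :=
    Measurable.ite hset measurable_const measurable_const
  refine ⟨_, hφ, fun h => by split_ifs <;> norm_num, ?_, fun θ hθ => ?_⟩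
  -- Type I error: with the roles exchanged, θ₀ is the centre of the alternative, so the loss term
  -- is 0.
  · refine integral_le_of_lintegral_le hBpos.le (hφ.comp (measurable_hist t))
      (fun ω => by split_ifs <;> norm_num)
      (g := fun ω => Real.exp (-M.totalScore θ₁ θ₀ k l n ω / 8)) (fun ω => ?_) ?_
    · rw [totalScore_embedHist M θ₀ θ₁ ht0 hnt', totalScore_swap M θ₀ θ₁, neg_neg]
      split_ifs with h
      · exact Real.one_le_exp (by linarith)
      · exact (Real.exp_pos _).le
    · refine (lintegral_exp_totalScore_le M lam π ι hk hl hα hμ hν hU θ₀ θ₁ θ₀ (sq_nonneg d)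
        le_rfl ?_ (dν := 0) ?_ n).trans (ENNReal.ofReal_le_ofReal ?_)
      · rw [← hDμ]
        simp only [hellingerSq_comm M θ₁ θ₀]
      · simp [hellingerSq_self]
      · rw [hB]
        refine Real.exp_le_exp.2 ?_
        have : ∑ i ∈ Finset.range n, (9 * 0 - α ((i + 1) * (k + l)) * d ^ 2 / 128) =
            -(s * d ^ 2 / 128) := by
          rw [hs, Finset.sum_mul, Finset.sum_div, ← Finset.sum_neg_distrib]
          simp
        rw [this]
        have : 0 ≤ s * d ^ 2 := by linarith
        linarith
  · have hlast : alphaLast k l α t = α (n * (k + l)) := by rw [alphaLast, hn, Nat.add_sub_cancel]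
    have hal := hα (n * (k + l))
    rw [hlast, hdd, ← ENNReal.ofReal_mul (by positivity)] at hθ
    have hνt := ne_top_of_le_ne_top ENNReal.ofReal_ne_top hθ
    obtain ⟨e, he0, he⟩ : ∃ e : ℝ, 0 ≤ e ∧ M.dist lam ν θ θ₁ = ENNReal.ofReal e :=
      ⟨_, ENNReal.toReal_nonneg, (ENNReal.ofReal_toReal hνt).symm⟩
    rw [he, ENNReal.ofReal_le_ofReal_iff (by positivity)] at hθ
    -- 2304 = 48², so 9e² is at most α d²/256, half the gain of the last and smallest block. A rate
    -- of 1/256 per block remains, and dropping block 0 halves it to K = 1/512.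
    have he2 : e ^ 2 ≤ α (n * (k + l)) * d ^ 2 / 2304 := by
      calc e ^ 2 ≤ (1 / 48 * √(α (n * (k + l))) * d) ^ 2 := by gcongr
        _ = _ := by rw [mul_pow, mul_pow, Real.sq_sqrt hal.le]; ring
    refine integral_le_of_lintegral_le hBpos.le ((hφ.comp (measurable_hist t)).const_sub 1)
      (fun ω => by split_ifs <;> norm_num)
      (g := fun ω => Real.exp (-M.totalScore θ₀ θ₁ k l n ω / 8)) (fun ω => ?_) ?_
    · rw [totalScore_embedHist M θ₀ θ₁ ht0 hnt']
      split_ifs with h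
      · simpa using (Real.exp_pos _).le
      · rw [sub_zero]
        exact Real.one_le_exp (by linarith)
    · refine (lintegral_exp_totalScore_le M lam π ι hk hl hα hμ hν hU θ θ₀ θ₁ (sq_nonneg d)
        (sq_nonneg e) hDμ ?_ n).trans (ENNReal.ofReal_le_ofReal ?_)
      · rw [← dist_sq, he, ENNReal.ofReal_pow he0]
      · rw [hB]
        refine Real.exp_le_exp.2 ?_
        calc _ ≤ ∑ i ∈ Finset.range n, -(α ((i + 1) * (k + l)) * d ^ 2 / 256) := by
              refine Finset.sum_le_sum fun i hi => ?_
              have : α (n * (k + l)) * d ^ 2 ≤ α ((i + 1) * (k + l)) * d ^ 2 :=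
                mul_le_mul_of_nonneg_right (hanti (Nat.mul_le_mul_right _ (Finset.mem_range.1 hi)))
                  (sq_nonneg d)
              linarith
          _ = -(s * d ^ 2 / 256) := by
              rw [hs, Finset.sum_mul, Finset.sum_div, ← Finset.sum_neg_distrib]
          _ ≤ _ := by linarith

/-! ### Lower bound for the evidence -/

/-- Young's inequality for the function `r ↦ r log r + 1 - r`. -/
theorem mul_add_one_sub_exp_le_klFun {r : ℝ} (hr : 0 ≤ r) (a : ℝ) :
    a * r + 1 - Real.exp a ≤ InformationTheory.klFun r := by
  rw [InformationTheory.klFun_apply]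
  rcases hr.eq_or_lt with rfl | hr
  · simp [(Real.exp_pos a).le]
  · have h := Real.add_one_le_exp (a - Real.log r)
    rw [Real.exp_sub, Real.exp_log hr, le_div_iff₀ hr] at h
    linarith

/-- If `Q ≤ e^{-a} P` on a set, the Kullback-Leibler divergence bounds the mass of the set. -/
theorem ofReal_mul_measure_le_klDiv {X : Type*} [MeasurableSpace X] {P Q : Measure X}
    [IsFiniteMeasure P] [IsFiniteMeasure Q] {E : Set X} {a : ℝ} (ha : 0 ≤ a)
    (hQ : ENNReal.ofReal (Real.exp a) * Q E ≤ P E) :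
    ENNReal.ofReal a * P E ≤ InformationTheory.klDiv P Q + P E := by
  by_cases hac : P ≪ Q
  swap
  · rw [InformationTheory.klDiv_of_not_ac hac]
    simp
  rw [InformationTheory.klDiv_eq_lintegral_klFun_of_ac hac]
  have hm : Measurable fun x => ENNReal.ofReal (InformationTheory.klFun (P.rnDeriv Q x).toReal) :=
    ENNReal.measurable_ofReal.comp (InformationTheory.measurable_klFun.comp
      (Measure.measurable_rnDeriv P Q).ennreal_toReal)
  -- Young's inequality is integrated over E and the term e^a Q(E) is absorbed by the hypothesis.
  -- The term P E stays on the right to avoid truncated subtraction.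
  calc ENNReal.ofReal a * P E = ∫⁻ x in E, ENNReal.ofReal a * P.rnDeriv Q x ∂Q := by
        rw [lintegral_const_mul _ (Measure.measurable_rnDeriv P Q),
          Measure.setLIntegral_rnDeriv hac]
    _ ≤ ∫⁻ x in E, (ENNReal.ofReal (InformationTheory.klFun (P.rnDeriv Q x).toReal) +
          ENNReal.ofReal (Real.exp a)) ∂Q := by
        refine lintegral_mono_ae (ae_restrict_of_ae ?_)
        filter_upwards [Measure.rnDeriv_lt_top P Q] with x hx
        obtain ⟨r, hr⟩ : ∃ r, r = (P.rnDeriv Q x).toReal := ⟨_, rfl⟩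
        have hr0 : 0 ≤ r := hr ▸ ENNReal.toReal_nonneg
        rw [← ENNReal.ofReal_toReal hx.ne, ← hr, ENNReal.toReal_ofReal hr0,
          ← ENNReal.ofReal_mul ha,
          ← ENNReal.ofReal_add (InformationTheory.klFun_nonneg hr0) (Real.exp_pos a).le]
        refine ENNReal.ofReal_le_ofReal ?_
        linarith [mul_add_one_sub_exp_le_klFun hr0 a]
    _ = ∫⁻ x in E, ENNReal.ofReal (InformationTheory.klFun (P.rnDeriv Q x).toReal) ∂Q +
          ENNReal.ofReal (Real.exp a) * Q E := by
        rw [lintegral_add_left hm, setLIntegral_const]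
    _ ≤ _ := by
        gcongr
        exact Measure.restrict_le_self

theorem likelihood_ne_top (M : Model Θ S A) (t : ℕ) (h : Hist S A t) (θ : Θ) :
    M.likelihood t h θ ≠ ∞ :=
  ENNReal.prod_ne_top fun _ _ => ENNReal.coe_ne_top

theorem measurable_likelihood_left (M : Model Θ S A) (t : ℕ) (θ : Θ) :
    Measurable fun h => M.likelihood t h θ :=
  (measurable_likelihood M t).comp measurable_prodMk_right

theorem measurable_likelihood_right (M : Model Θ S A) (t : ℕ) (h : Hist S A t) :
    Measurable fun θ => M.likelihood t h θ :=
  (measurable_likelihood M t).comp measurable_prodMk_left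

theorem ae_likelihood_ne_zero (M : Model Θ S A) (π : Policy S A) (ι : Measure S)
    [IsProbabilityMeasure ι] (θ : Θ) (t : ℕ) :
    ∀ᵐ h ∂(M.histLaw π ι θ t), M.likelihood t h θ ≠ 0 := by
  obtain ⟨R, hR⟩ := exists_histLaw_withDensity M π ι t
  rw [hR, ae_withDensity_iff (measurable_likelihood_left M t θ)]
  exact ae_of_all _ fun _ h => h

/-- Change of measure from θ₀ to θ. Only an inequality holds, because the mass of P_θ where the
likelihood of θ₀ vanishes is lost. -/
theorem lintegral_likelihood_div_mul_le (M : Model Θ S A) (π : Policy S A) (ι : Measure S)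
    [IsProbabilityMeasure ι] (θ₀ θ : Θ) (t : ℕ) {g : Hist S A t → ℝ≥0∞} (hg : Measurable g) :
    ∫⁻ h, M.likelihood t h θ / M.likelihood t h θ₀ * g h ∂(M.histLaw π ι θ₀ t) ≤
      ∫⁻ h, g h ∂(M.histLaw π ι θ t) := by
  obtain ⟨R, hR⟩ := exists_histLaw_withDensity M π ι t
  have hL := measurable_likelihood_left M t
  have hm : Measurable fun h => M.likelihood t h θ / M.likelihood t h θ₀ * g h :=
    ((hL θ).div (hL θ₀)).mul hg
  rw [hR, hR, lintegral_withDensity_eq_lintegral_mul _ (hL θ₀) hm,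
    lintegral_withDensity_eq_lintegral_mul _ (hL θ) hg]
  refine lintegral_mono fun h => ?_
  simp only [Pi.mul_apply, ← mul_assoc]
  exact mul_le_mul' ENNReal.mul_div_le le_rfl

theorem histLaw_likelihood_le (M : Model Θ S A) (π : Policy S A) (ι : Measure S)
    [IsProbabilityMeasure ι] (θ₀ θ : Θ) (t : ℕ) (a : ℝ≥0∞) :
    a * M.histLaw π ι θ t {h | a * M.likelihood t h θ ≤ M.likelihood t h θ₀} ≤
      M.histLaw π ι θ₀ t {h | a * M.likelihood t h θ ≤ M.likelihood t h θ₀} := by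
  obtain ⟨R, hR⟩ := exists_histLaw_withDensity M π ι t
  have hL := measurable_likelihood_left M t
  have hE : MeasurableSet {h | a * M.likelihood t h θ ≤ M.likelihood t h θ₀} :=
    measurableSet_le ((hL θ).const_mul a) (hL θ₀)
  rw [hR, hR, withDensity_apply _ hE, withDensity_apply _ hE, ← lintegral_const_mul _ (hL θ)]
  exact setLIntegral_mono (hL θ₀) fun h hh => hh

/-- The event that θ₀ beats θ by a factor e^a satisfies e^a P_θ(E) ≤ P_{θ₀}(E), so (a − 1) P_{θ₀}(E)
is at most the divergence. -/
theorem histLaw_likelihood_le_of_klDiv (M : Model Θ S A) (π : Policy S A) (ι : Measure S)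
    [IsProbabilityMeasure ι] (θ₀ θ : Θ) (t : ℕ) {x a : ℝ} (ha : 1 < a)
    (hkl : InformationTheory.klDiv (M.histLaw π ι θ₀ t) (M.histLaw π ι θ t) ≤ ENNReal.ofReal x) :
    M.histLaw π ι θ₀ t
        {h | ENNReal.ofReal (Real.exp a) * M.likelihood t h θ ≤ M.likelihood t h θ₀} ≤
      ENNReal.ofReal (x / (a - 1)) := by
  have h := ofReal_mul_measure_le_klDiv (a := a) (by linarith)
    (histLaw_likelihood_le M π ι θ₀ θ t (ENNReal.ofReal (Real.exp a)))
  obtain ⟨E, hE⟩ : ∃ E, E =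
    {h | ENNReal.ofReal (Real.exp a) * M.likelihood t h θ ≤ M.likelihood t h θ₀} := ⟨_, rfl⟩
  rw [← hE] at h ⊢
  replace h := h.trans (add_le_add_left hkl _)
  obtain ⟨p, hp0, hp⟩ : ∃ p : ℝ, 0 ≤ p ∧ M.histLaw π ι θ₀ t E = ENNReal.ofReal p :=
    ⟨_, ENNReal.toReal_nonneg, (ENNReal.ofReal_toReal (measure_ne_top _ _)).symm⟩
  rw [hp] at h ⊢
  have h1 : ENNReal.ofReal ((a - 1) * p) ≤ ENNReal.ofReal x := by
    rw [sub_mul, one_mul, ENNReal.ofReal_sub _ hp0, ENNReal.ofReal_mul (by linarith)]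
    exact tsub_le_iff_right.2 h
  rcases le_total 0 x with hx | hx
  · refine ENNReal.ofReal_le_ofReal ?_
    rw [le_div_iff₀ (by linarith), mul_comm]
    exact (ENNReal.ofReal_le_ofReal_iff hx).1 h1
  · rw [ENNReal.ofReal_of_nonpos hx, nonpos_iff_eq_zero, ENNReal.ofReal_eq_zero] at h1
    have : p ≤ 0 := by nlinarith
    rw [ENNReal.ofReal_of_nonpos this]
    exact zero_le

/-- The lower bound on the evidence: it is at least `e^{-a} P(B) / 2` times the true likelihood,
up to an event of small probability. -/
theorem histLaw_evidence_le (M : Model Θ S A) (π : Policy S A) (ι : Measure S)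
    [IsProbabilityMeasure ι] (θ₀ : Θ) (t : ℕ) (P : Measure Θ) [IsFiniteMeasure P] {B : Set Θ}
    (hPB : P B ≠ 0) {x a : ℝ} (ha : 1 < a)
    (hB : ∀ θ ∈ B, InformationTheory.klDiv (M.histLaw π ι θ₀ t) (M.histLaw π ι θ t) ≤
      ENNReal.ofReal x) :
    M.histLaw π ι θ₀ t {h | ENNReal.ofReal (Real.exp a) * ∫⁻ θ, M.likelihood t h θ ∂P <
      M.likelihood t h θ₀ * (P B / 2)} ≤ 2 * ENNReal.ofReal (x / (a - 1)) := by
  obtain ⟨δ, hδ⟩ : ∃ δ, δ = ENNReal.ofReal (x / (a - 1)) := ⟨_, rfl⟩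
  obtain ⟨c, hc⟩ : ∃ c, c = ENNReal.ofReal (Real.exp a) := ⟨_, rfl⟩
  obtain ⟨P₀, hP₀, hP₀p⟩ : ∃ P₀, P₀ = M.histLaw π ι θ₀ t ∧ IsProbabilityMeasure P₀ :=
    ⟨_, rfl, inferInstance⟩
  have hL := measurable_likelihood M t
  have hD : MeasurableSet {p : Hist S A t × Θ |
      c * M.likelihood t p.1 p.2 ≤ M.likelihood t p.1 θ₀} :=
    measurableSet_le (hL.const_mul c) ((measurable_likelihood_left M t θ₀).comp measurable_fst)
  obtain ⟨D, hDdef⟩ : ∃ D, D = {p : Hist S A t × Θ |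
      c * M.likelihood t p.1 p.2 ≤ M.likelihood t p.1 θ₀} := ⟨_, rfl⟩
  rw [← hDdef] at hD
  -- B is not assumed measurable, so it is enlarged to the measurable set B' of all θ that are
  -- unlikely to be beaten by the factor e^a.
  have hB'm : MeasurableSet {θ | P₀ ((fun h => (h, θ)) ⁻¹' D) ≤ δ} :=
    measurableSet_le (measurable_measure_prodMk_right hD) measurable_const
  obtain ⟨B', hB'⟩ : ∃ B', B' = {θ | P₀ ((fun h => (h, θ)) ⁻¹' D) ≤ δ} := ⟨_, rfl⟩
  rw [← hB'] at hB'm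
  have hBB' : P B ≤ P B' := by
    refine measure_mono fun θ hθ => ?_
    rw [hB', hδ, hP₀, hDdef, hc]
    exact histLaw_likelihood_le_of_klDiv M π ι θ₀ θ t ha (hB θ hθ)
  have hmm : Measurable fun h => (P.restrict B') (Prod.mk h ⁻¹' D) :=
    measurable_measure_prodMk_left hD
  -- Fubini: the prior mass of the badly beaten θ in B' is at most δ P(B') on average. By Markov's
  -- inequality it is at least P(B')/2 only with probability at most 2δ; otherwise the other half of
  -- B' supports the evidence.
  have hint : ∫⁻ h, (P.restrict B') (Prod.mk h ⁻¹' D) ∂P₀ ≤ δ * P B' := by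
    rw [← Measure.prod_apply hD, Measure.prod_apply_symm hD, ← setLIntegral_const]
    exact setLIntegral_mono measurable_const fun θ hθ => by rwa [hB'] at hθ
  have hP0 : P B' ≠ 0 := fun h => hPB (le_antisymm (h ▸ hBB') zero_le)
  have hPt : P B' ≠ ∞ := measure_ne_top _ _
  have hmarkov : P₀ {h | P B' / 2 ≤ (P.restrict B') (Prod.mk h ⁻¹' D)} ≤ 2 * δ := by
    refine (meas_ge_le_lintegral_div hmm.aemeasurable (ENNReal.half_pos hP0).ne'
      (ENNReal.div_ne_top hPt two_ne_zero)).trans ?_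
    refine ENNReal.div_le_of_le_mul (hint.trans_eq ?_)
    rw [mul_assoc, mul_left_comm, ENNReal.mul_div_cancel two_ne_zero ENNReal.ofNat_ne_top]
  rw [← hP₀, ← hδ, ← hc]
  refine (measure_mono fun h hh => ?_).trans hmarkov
  rw [Set.mem_ofPred_eq] at hh ⊢
  by_contra! hlt
  refine hh.not_ge ?_
  have hDh : MeasurableSet (Prod.mk h ⁻¹' D) := measurable_prodMk_left hD
  have hgood : P B' / 2 ≤ (P.restrict B') (Prod.mk h ⁻¹' D)ᶜ := by
    have h1 := measure_add_measure_compl (μ := P.restrict B') hDh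
    rw [Measure.restrict_apply_univ] at h1
    have h2 : P B' / 2 + P B' / 2 ≤ P B' / 2 + (P.restrict B') (Prod.mk h ⁻¹' D)ᶜ := by
      rw [ENNReal.add_halves]
      conv_lhs => rw [← h1]
      gcongr
    exact (ENNReal.add_le_add_iff_left (ENNReal.div_ne_top hPt two_ne_zero)).1 h2
  calc M.likelihood t h θ₀ * (P B / 2)
      ≤ M.likelihood t h θ₀ * (P.restrict B') (Prod.mk h ⁻¹' D)ᶜ := by
        gcongr
        exact (ENNReal.div_le_div_right hBB' 2).trans hgood
    _ = ∫⁻ θ in (Prod.mk h ⁻¹' D)ᶜ, M.likelihood t h θ₀ ∂(P.restrict B') :=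
        (setLIntegral_const _ _).symm
    _ ≤ ∫⁻ θ in (Prod.mk h ⁻¹' D)ᶜ, c * M.likelihood t h θ ∂(P.restrict B') := by
        refine setLIntegral_mono ((measurable_likelihood_right M t h).const_mul c) fun θ hθ => ?_
        have hθ' : ¬ c * M.likelihood t h θ ≤ M.likelihood t h θ₀ := by rwa [hDdef] at hθ
        exact (not_le.1 hθ').le
    _ ≤ ∫⁻ θ, c * M.likelihood t h θ ∂P :=
        lintegral_mono' (Measure.restrict_le_self.trans Measure.restrict_le_self) le_rfl
    _ = _ := lintegral_const_mul _ (measurable_likelihood_right M t h)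

/-! ### The semi-distances, covers and shells -/

theorem dist_eq_lintegral_prod (M : Model Θ S A) (lam : Measure (S × A)) [SFinite lam]
    {ν : S × A → ℝ≥0} (hν : Measurable ν) (θ θ' : Θ) :
    M.dist lam ν θ θ' = (∫⁻ p, ENNReal.ofReal
      |√(M.dens θ p.1 p.2 : ℝ) - √(M.dens θ' p.1 p.2 : ℝ)| ^ (2 : ℝ)
      ∂((lam.withDensity fun x => (ν x : ℝ≥0∞)).prod M.base)) ^ (1 / 2 : ℝ) := by
  have hr : ∀ θ, Measurable fun p : (S × A) × S => √(M.dens θ p.1 p.2 : ℝ) := fun θ =>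
    (measurable_dens_comp M measurable_const measurable_fst measurable_snd).coe_nnreal_real.sqrt
  have hm : Measurable fun p : (S × A) × S => ENNReal.ofReal
      |√(M.dens θ p.1 p.2 : ℝ) - √(M.dens θ' p.1 p.2 : ℝ)| ^ (2 : ℝ) :=
    ((hr θ).sub (hr θ')).abs.ennreal_ofReal.pow_const (2 : ℝ)
  have he : ∀ x, ∫⁻ s, ENNReal.ofReal |√(M.dens θ x s : ℝ) - √(M.dens θ' x s : ℝ)| ^ (2 : ℝ)
      ∂M.base = M.hellingerSq θ θ' x := fun x => lintegral_congr fun s => by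
    rw [ENNReal.ofReal_rpow_of_nonneg (abs_nonneg _) zero_le_two, Real.rpow_ofNat, sq_abs]
  rw [Model.dist, lintegral_prod _ hm.aemeasurable]
  congr 1
  simp only [he]
  rw [lintegral_withDensity_eq_lintegral_mul _ hν.coe_nnreal_ennreal
    (measurable_hellingerSq_right M θ θ')]
  simp [mul_comm]

/-- d_ν is the L² distance of the square-root densities under the product of ν dλ and m, so this is
Minkowski's inequality. -/
theorem dist_triangle (M : Model Θ S A) (lam : Measure (S × A)) [SFinite lam]
    {ν : S × A → ℝ≥0} (hν : Measurable ν) (θ θ' θ'' : Θ) :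
    M.dist lam ν θ θ'' ≤ M.dist lam ν θ θ' + M.dist lam ν θ' θ'' := by
  have hr : ∀ θ, Measurable fun p : (S × A) × S => √(M.dens θ p.1 p.2 : ℝ) := fun θ =>
    (measurable_dens_comp M measurable_const measurable_fst measurable_snd).coe_nnreal_real.sqrt
  have hm := fun θ θ' => ((hr θ).sub (hr θ')).abs.ennreal_ofReal
  simp only [dist_eq_lintegral_prod M lam hν]
  refine le_trans ?_ (ENNReal.lintegral_Lp_add_le (hm θ θ').aemeasurable
    (hm θ' θ'').aemeasurable one_le_two)
  gcongr with p
  rw [Pi.add_apply, ← ENNReal.ofReal_add (abs_nonneg _) (abs_nonneg _)]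
  exact ENNReal.ofReal_le_ofReal (abs_sub_le _ _ _)

theorem measurable_dist_left (M : Model Θ S A) (lam : Measure (S × A)) [SFinite lam]
    {μ : S × A → ℝ≥0} (hμ : Measurable μ) (θ₀ : Θ) : Measurable fun θ => M.dist lam μ θ θ₀ := by
  refine Measurable.pow_const (Measurable.lintegral_prod_right' (ν := lam)
    (f := fun q : Θ × (S × A) => M.hellingerSq q.1 θ₀ q.2 * μ q.2) ?_) _
  exact ((measurable_hellingerSq M).comp
    (measurable_fst.prodMk (measurable_const.prodMk measurable_snd))).mul
    (hμ.comp measurable_snd).coe_nnreal_ennreal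

theorem exists_finset_cover_of_coveringNumber {Θ : Type*} {T : Set Θ} {d : Θ → Θ → ℝ≥0∞} {r : ℝ≥0∞} {x : ℝ}
    (h : ENNReal.log (ENat.toENNReal (coveringNumber r T d)) ≤ (x : EReal)) :
    ∃ C : Finset Θ, (C.card : ℝ≥0∞) ≤ ENNReal.ofReal (Real.exp x) ∧
      ∀ θ ∈ T, ∃ c ∈ C, d θ c ≤ r := by
  have h1 := EReal.exp_monotone h
  rw [ENNReal.exp_log, EReal.exp_coe] at h1
  have htop : coveringNumber r T d ≠ ⊤ := by
    intro he
    rw [he] at h1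
    simp at h1
  -- A finite infimum in ℕ∞ is attained; a cover of size below N + 1 is extracted.
  have hlt : coveringNumber r T d < coveringNumber r T d + 1 := (ENat.lt_add_one_iff htop).2 le_rfl
  conv_lhs at hlt => rw [coveringNumber]
  simp only [iInf_lt_iff] at hlt
  obtain ⟨C, hC, hlt⟩ := hlt
  have hle := (ENat.lt_add_one_iff htop).1 hlt
  have hfin : C.Finite := Set.encard_lt_top_iff.1 (hle.trans_lt htop.lt_top)
  refine ⟨hfin.toFinset, le_trans ?_ h1, by simpa using hC⟩
  rw [← ENat.toENNReal_le, hfin.encard_eq_coe_toFinset_card] at hle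
  simpa using hle

/-- The `j`-th shell around `θ₀`. -/
def Model.shell (M : Model Θ S A) (lam : Measure (S × A)) (μ : S × A → ℝ≥0) (θ₀ : Θ) (r : ℝ)
    (j : ℕ) : Set Θ :=
  {θ | ENNReal.ofReal (j * r) < M.dist lam μ θ θ₀ ∧
    M.dist lam μ θ θ₀ ≤ ENNReal.ofReal ((j + 1) * r)}

theorem measurableSet_shell (M : Model Θ S A) (lam : Measure (S × A)) [SFinite lam]
    {μ : S × A → ℝ≥0} (hμ : Measurable μ) (θ₀ : Θ) (r : ℝ) (j : ℕ) :
    MeasurableSet (M.shell lam μ θ₀ r j) :=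
  have hd := measurable_dist_left M lam hμ θ₀
  (measurableSet_lt measurable_const hd).inter (measurableSet_le hd measurable_const)

theorem setOf_lt_dist_subset_iUnion_shell (M : Model Θ S A) (lam : Measure (S × A))
    (μ : S × A → ℝ≥0) (θ₀ : Θ) (htop : ∀ θ, M.dist lam μ θ θ₀ ≠ ∞) {r m : ℝ} (hr : 0 < r) {n : ℕ}
    (hn : (n : ℝ) ≤ m) :
    {θ | ENNReal.ofReal (m * r) < M.dist lam μ θ θ₀} ⊆ ⋃ i : ℕ, M.shell lam μ θ₀ r (n + i) := by
  intro θ hθ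
  obtain ⟨d, hd0, hd⟩ : ∃ d : ℝ, 0 ≤ d ∧ M.dist lam μ θ θ₀ = ENNReal.ofReal d :=
    ⟨_, ENNReal.toReal_nonneg, (ENNReal.ofReal_toReal (htop θ)).symm⟩
  have hθ' : ENNReal.ofReal (m * r) < M.dist lam μ θ θ₀ := hθ
  rw [hd, ENNReal.ofReal_lt_ofReal_iff'] at hθ'
  have hmd : m < d / r := (lt_div_iff₀ hr).2 hθ'.1
  -- The shell index is ⌈d/r⌉ − 1, since shells are open below and closed above.
  have hlt : n < ⌈d / r⌉₊ := Nat.lt_ceil.2 (hn.trans_lt hmd)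
  obtain ⟨i, hi⟩ : ∃ i, ⌈d / r⌉₊ = n + i + 1 := ⟨⌈d / r⌉₊ - n - 1, by omega⟩
  have h1 : ((n + i : ℕ) : ℝ) < d / r := Nat.lt_ceil.1 (by omega)
  have h2 : d / r ≤ ((n + i : ℕ) : ℝ) + 1 := by
    have := Nat.le_ceil (d / r)
    rw [hi] at this
    exact_mod_cast this
  refine Set.mem_iUnion.2 ⟨i, ?_, ?_⟩
  · rw [hd, ENNReal.ofReal_lt_ofReal_iff']
    exact ⟨(lt_div_iff₀ hr).1 h1, hθ'.2⟩
  · rw [hd]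
    exact ENNReal.ofReal_le_ofReal ((div_le_iff₀ hr).1 h2)

/-! ### Tests against whole shells -/

theorem mul_epsBar_sq {k l : ℕ} {α ε : ℕ → ℝ} (hα : ∀ i, 0 < α i) (t : ℕ) :
    t * epsBar k l α ε t ^ 2 = alphaSum k l α t * ε t ^ 2 := by
  have h0 : 0 ≤ alphaSum k l α t := Finset.sum_nonneg fun _ _ => (hα _).le
  rw [epsBar, Real.sq_sqrt (by positivity)]
  rcases t.eq_zero_or_pos with rfl | ht
  · simp [alphaSum]
  · field_simp

theorem HasTests.exists_lintegral {M : Model Θ S A} {lam : Measure (S × A)} {π : Policy S A}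
    {ι : Measure S} [IsProbabilityMeasure ι] {k l : ℕ} {α : ℕ → ℝ} {μ ν : S × A → ℝ≥0} {K ξ : ℝ}
    (hT : HasTests M lam π ι k l α μ ν K ξ) (θ₀ θ₁ : Θ) (t : ℕ) :
    ∃ φ : Hist S A t → ℝ≥0∞, Measurable φ ∧ (∀ h, φ h ≤ 1) ∧
      ∫⁻ h, φ h ∂(M.histLaw π ι θ₀ t) ≤ ENNReal.ofReal
        (Real.exp (-K * alphaSum k l α t * (M.dist lam μ θ₀ θ₁).toReal ^ 2)) ∧
      ∀ θ, M.dist lam ν θ θ₁ ≤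
          ENNReal.ofReal (ξ * √(alphaLast k l α t)) * M.dist lam μ θ₀ θ₁ →
        ∫⁻ h, (1 - φ h) ∂(M.histLaw π ι θ t) ≤ ENNReal.ofReal
          (Real.exp (-K * alphaSum k l α t * (M.dist lam μ θ₀ θ₁).toReal ^ 2)) := by
  obtain ⟨φ, hφ, h01, hI, hII⟩ := hT θ₀ θ₁ t
  have hconv : ∀ (θ : Θ) (f : Hist S A t → ℝ), Measurable f → (∀ h, 0 ≤ f h ∧ f h ≤ 1) →
      ∫⁻ h, ENNReal.ofReal (f h) ∂(M.histLaw π ι θ t) =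
        ENNReal.ofReal (∫ ω, f (hist t ω) ∂(M.law π ι θ)) := by
    intro θ f hf hf01
    have hfm : Measurable fun ω : Traj S A => f (hist t ω) := hf.comp (measurable_hist t)
    rw [Model.histLaw, lintegral_map hf.ennreal_ofReal (measurable_hist t),
      ofReal_integral_eq_lintegral_ofReal _ (ae_of_all _ fun ω => (hf01 _).1)]
    refine Integrable.of_bound hfm.aestronglyMeasurable 1 (ae_of_all _ fun ω => ?_)
    rw [Real.norm_of_nonneg (hf01 _).1]
    exact (hf01 _).2
  refine ⟨fun h => ENNReal.ofReal (φ h), hφ.ennreal_ofReal, fun h => ?_, ?_, fun θ hθ => ?_⟩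
  · exact ENNReal.ofReal_le_one.2 (h01 h).2
  · rw [hconv θ₀ φ hφ h01]
    exact ENNReal.ofReal_le_ofReal hI
  · have : ∀ h, 1 - ENNReal.ofReal (φ h) = ENNReal.ofReal (1 - φ h) := fun h => by
      rw [ENNReal.ofReal_sub _ (h01 h).1, ENNReal.ofReal_one]
    simp only [this]
    rw [hconv θ (fun h => 1 - φ h) (hφ.const_sub 1)
      fun h => ⟨by linarith [(h01 h).2], by linarith [(h01 h).1]⟩]
    exact ENNReal.ofReal_le_ofReal (hII θ hθ)

/-- A test of `θ₀` against a whole shell. -/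
theorem exists_test_shell {M : Model Θ S A} {lam : Measure (S × A)} [SFinite lam] {π : Policy S A}
    {ι : Measure S} [IsProbabilityMeasure ι] {k l : ℕ} {α : ℕ → ℝ} (hα : ∀ i, 0 < α i)
    {μ ν : S × A → ℝ≥0} (hν : Measurable ν) {K ξ : ℝ} (hK : 0 < K) (hξ : 0 < ξ)
    (hT : HasTests M lam π ι k l α μ ν K ξ) {θ₀ : Θ} (htop : ∀ θ, M.dist lam μ θ θ₀ ≠ ∞)
    {ε : ℕ → ℝ} {t : ℕ} (hε : 0 < ε t)
    (hent : EntropyBound M lam k l α μ ν (ξ / 2) θ₀ ε t) {j : ℕ} (hj : 2 ≤ j) {x : ℝ}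
    (hx : x = t * epsBar k l α ε t ^ 2) :
    ∃ φ : Hist S A t → ℝ≥0∞, Measurable φ ∧
      ∫⁻ h, φ h ∂(M.histLaw π ι θ₀ t) ≤ ENNReal.ofReal (Real.exp (x - K * x * j ^ 2)) ∧
      ∀ θ ∈ M.shell lam μ θ₀ (ε t) j,
        ∫⁻ h, (1 - φ h) ∂(M.histLaw π ι θ t) ≤ ENNReal.ofReal (Real.exp (-(K * x * j ^ 2))) := by
  have hj2 : (2 : ℝ) ≤ j := by exact_mod_cast hj
  have hxα : x = alphaSum k l α t * ε t ^ 2 := by rw [hx, mul_epsBar_sq hα]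
  have h0 : 0 ≤ alphaSum k l α t := Finset.sum_nonneg fun _ _ => (hα _).le
  -- The entropy bound is used at radius 2jε: for j ≥ 2 it exceeds the outer radius (j + 1)ε, so the
  -- cover reaches the whole shell.
  have hr : ε t < 2 * j * ε t := by nlinarith
  have hent' := (le_iSup (fun r : Set.Ioi (ε t) => ENNReal.log (ENat.toENNReal (coveringNumber
      (ENNReal.ofReal (1 / 2 * √(alphaLast k l α t) * (ξ / 2) * r))
      {θ : Θ | M.dist lam μ θ θ₀ < ENNReal.ofReal r} (M.dist lam ν)))) ⟨2 * j * ε t, hr⟩).trans hent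
  rw [← hx] at hent'
  obtain ⟨C, hCcard, hC⟩ := exists_finset_cover_of_coveringNumber hent'
  obtain ⟨ρ, hρ⟩ : ∃ ρ, ρ = ENNReal.ofReal
    (1 / 2 * √(alphaLast k l α t) * (ξ / 2) * (2 * j * ε t)) := ⟨_, rfl⟩
  simp only [← hρ] at hC
  have hlocal : ∀ c : Θ, ∃ φ : Hist S A t → ℝ≥0∞, Measurable φ ∧
      ∫⁻ h, φ h ∂(M.histLaw π ι θ₀ t) ≤ ENNReal.ofReal (Real.exp (-(K * x * j ^ 2))) ∧
      ∀ θ ∈ M.shell lam μ θ₀ (ε t) j, M.dist lam ν θ c ≤ ρ →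
        ∫⁻ h, (1 - φ h) ∂(M.histLaw π ι θ t) ≤ ENNReal.ofReal (Real.exp (-(K * x * j ^ 2))) := by
    intro c
    -- A centre c need not lie in the shell, so the test is recentred at a shell point θ₁ within ρ
    -- of c. This doubles the radius, and 2ρ = ξ √α jε is still at most ξ √α d_μ(θ₀,θ₁). The room
    -- comes from the entropy bound being stated with ξ/2.
    by_cases hc : ∃ θ₁ ∈ M.shell lam μ θ₀ (ε t) j, M.dist lam ν θ₁ c ≤ ρ
    swap
    · push Not at hc
      exact ⟨fun _ => 0, measurable_const, by simp, fun θ hθ h => absurd h (hc θ hθ).not_ge⟩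
    obtain ⟨θ₁, hθ₁, hcθ₁⟩ := hc
    obtain ⟨φ, hφ, -, hI, hII⟩ := hT.exists_lintegral θ₀ θ₁ t
    obtain ⟨d, hd0, hd⟩ : ∃ d : ℝ, 0 ≤ d ∧ M.dist lam μ θ₁ θ₀ = ENNReal.ofReal d :=
      ⟨_, ENNReal.toReal_nonneg, (ENNReal.ofReal_toReal (htop θ₁)).symm⟩
    have hjd : j * ε t < d := by
      have := hθ₁.1
      rw [hd, ENNReal.ofReal_lt_ofReal_iff'] at this
      exact this.1
    rw [dist_comm M lam μ θ₀ θ₁, hd, ENNReal.toReal_ofReal hd0] at hI hII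
    have hexp : ENNReal.ofReal (Real.exp (-K * alphaSum k l α t * d ^ 2)) ≤
        ENNReal.ofReal (Real.exp (-(K * x * j ^ 2))) := by
      refine ENNReal.ofReal_le_ofReal (Real.exp_le_exp.2 ?_)
      have h1 : (j * ε t) ^ 2 ≤ d ^ 2 := by gcongr
      have h2 := mul_le_mul_of_nonneg_left h1 (mul_nonneg hK.le h0)
      rw [hxα]
      linarith
    refine ⟨φ, hφ, hI.trans hexp, fun θ hθ hcθ => (hII θ ?_).trans hexp⟩
    refine (dist_triangle M lam hν θ c θ₁).trans ?_
    rw [dist_comm M lam ν c θ₁]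
    refine (add_le_add hcθ hcθ₁).trans ?_
    have hs := Real.sqrt_nonneg (alphaLast k l α t)
    rw [hρ, ← ENNReal.ofReal_add (by positivity) (by positivity),
      ← ENNReal.ofReal_mul (by positivity)]
    refine ENNReal.ofReal_le_ofReal ?_
    have := mul_le_mul_of_nonneg_left hjd.le (mul_nonneg hξ.le hs)
    linarith
  choose φ hφ hI hII using hlocal
  refine ⟨fun h => ⨆ c ∈ (C : Set Θ), φ c h, Measurable.biSup _ C.countable_toSet fun c _ => hφ c,
    ?_, fun θ hθ => ?_⟩
  · calc ∫⁻ h, ⨆ c ∈ (C : Set Θ), φ c h ∂(M.histLaw π ι θ₀ t)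
        ≤ ∫⁻ h, ∑ c ∈ C, φ c h ∂(M.histLaw π ι θ₀ t) :=
          lintegral_mono fun h => iSup₂_le fun c hc =>
            Finset.single_le_sum (f := fun c => φ c h) (fun _ _ => zero_le) hc
      _ ≤ ∑ c ∈ C, ENNReal.ofReal (Real.exp (-(K * x * j ^ 2))) := by
          rw [lintegral_finsetSum _ fun c _ => hφ c]
          exact Finset.sum_le_sum fun c _ => hI c
      _ ≤ ENNReal.ofReal (Real.exp x) * ENNReal.ofReal (Real.exp (-(K * x * j ^ 2))) := by
          rw [Finset.sum_const, nsmul_eq_mul]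
          gcongr
      _ = _ := by
          rw [← ENNReal.ofReal_mul (Real.exp_pos _).le, ← Real.exp_add, sub_eq_add_neg]
  · have hθr : θ ∈ {θ : Θ | M.dist lam μ θ θ₀ < ENNReal.ofReal (2 * j * ε t)} := by
      refine hθ.2.trans_lt ((ENNReal.ofReal_lt_ofReal_iff (by positivity)).2 ?_)
      nlinarith
    obtain ⟨c, hcC, hc⟩ := hC θ hθr
    refine le_trans (lintegral_mono fun h => ?_) (hII c θ hθ hc)
    exact tsub_le_tsub_left (le_biSup (fun c => φ c h) (Finset.mem_coe.2 hcC)) 1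

/-! ### The posterior bound at a fixed time -/

theorem measurable_lintegral_likelihood_div (M : Model Θ S A) (t : ℕ) (θ₀ : Θ) (P : Measure Θ)
    [SFinite P] :
    Measurable fun h : Hist S A t => ∫⁻ θ, M.likelihood t h θ / M.likelihood t h θ₀ ∂P :=
  Measurable.lintegral_prod_right' (f := fun p : Hist S A t × Θ =>
    M.likelihood t p.1 p.2 / M.likelihood t p.1 θ₀)
    ((measurable_likelihood M t).div ((measurable_likelihood_left M t θ₀).comp measurable_fst))

/-- The posterior mass of a set that is covered by shells, outside the rejection region of a
test. -/
theorem lintegral_likelihood_div_shells_le (M : Model Θ S A) (lam : Measure (S × A)) [SFinite lam]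
    (π : Policy S A) (ι : Measure S) [IsProbabilityMeasure ι] {μ : S × A → ℝ≥0} (hμ : Measurable μ)
    (θ₀ : Θ) (t : ℕ) (P : Measure Θ) [SFinite P] {r : ℝ} {n : ℕ} {φ : Hist S A t → ℝ≥0∞}
    (hφ : Measurable φ) {C : Set Θ} (hC : C ⊆ ⋃ i : ℕ, M.shell lam μ θ₀ r (n + i)) {b : ℕ → ℝ≥0∞}
    (hb : ∀ i, ∀ θ ∈ M.shell lam μ θ₀ r (n + i),
      ∫⁻ h, (1 - φ h) ∂(M.histLaw π ι θ t) ≤ b i) :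
    ∫⁻ h, (1 - φ h) * ∫⁻ θ in C, M.likelihood t h θ / M.likelihood t h θ₀ ∂P
        ∂(M.histLaw π ι θ₀ t) ≤ ∑' i, P (M.shell lam μ θ₀ r (n + i)) * b i := by
  have h1φ : Measurable fun h => 1 - φ h := hφ.const_sub 1
  have hr : ∀ h, Measurable fun θ => M.likelihood t h θ / M.likelihood t h θ₀ := fun h =>
    (measurable_likelihood_right M t h).div_const _
  have hj : Measurable fun p : Hist S A t × Θ =>
      M.likelihood t p.1 p.2 / M.likelihood t p.1 θ₀ * (1 - φ p.1) :=
    ((measurable_likelihood M t).div ((measurable_likelihood_left M t θ₀).comp measurable_fst)).mul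
      (h1φ.comp measurable_fst)
  calc _ = ∫⁻ h, ∫⁻ θ in C, M.likelihood t h θ / M.likelihood t h θ₀ * (1 - φ h) ∂P
        ∂(M.histLaw π ι θ₀ t) := lintegral_congr fun h => by
          rw [lintegral_mul_const _ (hr h), mul_comm]
    _ = ∫⁻ θ in C, ∫⁻ h, M.likelihood t h θ / M.likelihood t h θ₀ * (1 - φ h)
        ∂(M.histLaw π ι θ₀ t) ∂P :=
          lintegral_lintegral_swap (f := fun h θ =>
            M.likelihood t h θ / M.likelihood t h θ₀ * (1 - φ h)) hj.aemeasurable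
    _ ≤ ∫⁻ θ in C, ∫⁻ h, (1 - φ h) ∂(M.histLaw π ι θ t) ∂P :=
          lintegral_mono fun θ => lintegral_likelihood_div_mul_le M π ι θ₀ θ t h1φ
    _ ≤ ∫⁻ θ in ⋃ i : ℕ, M.shell lam μ θ₀ r (n + i), ∫⁻ h, (1 - φ h) ∂(M.histLaw π ι θ t) ∂P :=
          lintegral_mono_set hC
    _ ≤ ∑' i, ∫⁻ θ in M.shell lam μ θ₀ r (n + i), ∫⁻ h, (1 - φ h) ∂(M.histLaw π ι θ t) ∂P :=
          lintegral_iUnion_le _ _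
    _ ≤ ∑' i, P (M.shell lam μ θ₀ r (n + i)) * b i := by
          refine ENNReal.tsum_le_tsum fun i => ?_
          rw [mul_comm, ← setLIntegral_const]
          exact setLIntegral_mono' (measurableSet_shell M lam hμ θ₀ r _) fun θ hθ => hb i θ hθ

/-- Dividing numerator and denominator by the true likelihood turns the evidence bound into a bound
on the posterior. The factor 4 collects the 2 from p/2 and the 2 from 1 − q ≥ 1/2. -/
theorem posterior_le_of_evidence (M : Model Θ S A) (t : ℕ) (h : Hist S A t) (θ₀ : Θ)
    (P : Measure Θ) (C : Set Θ) {p c q : ℝ≥0∞} (hp : p ≠ 0) (hpt : p ≠ ∞)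
    (hL : M.likelihood t h θ₀ ≠ 0)
    (hev : M.likelihood t h θ₀ * (p / 2) ≤ c * ∫⁻ θ, M.likelihood t h θ ∂P) (hq : q < 1 / 2) :
    M.posterior P t h C ≤ 4 * c / p *
      ((1 - q) * ∫⁻ θ in C, M.likelihood t h θ / M.likelihood t h θ₀ ∂P) := by
  obtain ⟨L, hLdef⟩ : ∃ L, L = M.likelihood t h θ₀ := ⟨_, rfl⟩
  obtain ⟨N, hN⟩ : ∃ N, N = ∫⁻ θ in C, M.likelihood t h θ ∂P := ⟨_, rfl⟩
  obtain ⟨D, hD⟩ : ∃ D, D = ∫⁻ θ, M.likelihood t h θ ∂P := ⟨_, rfl⟩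
  have hLt : L ≠ ∞ := hLdef ▸ likelihood_ne_top M t h θ₀
  have e1 : ∫⁻ θ in C, M.likelihood t h θ / M.likelihood t h θ₀ ∂P = N / L := by
    simp only [div_eq_mul_inv]
    rw [lintegral_mul_const _ (measurable_likelihood_right M t h), hN, hLdef]
  rw [← hLdef] at hL hev
  rw [← hD] at hev
  rw [e1, Model.posterior, ← hN, ← hD]
  have hq2 : 1 / 2 ≤ 1 - q := by
    refine ENNReal.le_sub_of_add_le_right (ne_top_of_lt hq) ?_
    calc (1 / 2 : ℝ≥0∞) + q ≤ 1 / 2 + 1 / 2 := by gcongr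
      _ = 1 := ENNReal.add_halves 1
  have hp2 : p / 2 ≠ 0 := (ENNReal.half_pos hp).ne'
  have hp2t : p / 2 ≠ ∞ := ENNReal.div_ne_top hpt two_ne_zero
  have hL2 : L ≤ c * D / (p / 2) := by
    rwa [ENNReal.le_div_iff_mul_le (Or.inl hp2) (Or.inl hp2t)]
  refine ENNReal.div_le_of_le_mul ?_
  calc N = N / L * L := (ENNReal.div_mul_cancel hL hLt).symm
    _ ≤ N / L * (c * D / (p / 2)) := mul_le_mul' le_rfl hL2
    _ = 4 * c / p * (1 / 2 * (N / L)) * D := by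
        have h4 : (4 : ℝ≥0∞) = 2 * 2 := by norm_num
        have h2 : (2 : ℝ≥0∞) * 2⁻¹ = 1 := ENNReal.mul_inv_cancel two_ne_zero ENNReal.ofNat_ne_top
        rw [div_eq_mul_inv (c * D), ENNReal.inv_div (Or.inl ENNReal.ofNat_ne_top)
          (Or.inl two_ne_zero), h4, one_div]
        simp only [div_eq_mul_inv]
        calc _ = 2 * c * p⁻¹ * (N * L⁻¹) * D := by ring
          _ = (2 * 2⁻¹) * (2 * c * p⁻¹ * (N * L⁻¹) * D) := by rw [h2, one_mul]
          _ = _ := by ring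
    _ ≤ _ := by gcongr

/-- The bound on the posterior at a fixed time. -/
theorem histLaw_le_posterior_le {M : Model Θ S A} {lam : Measure (S × A)} [SFinite lam]
    {π : Policy S A} {ι : Measure S} [IsProbabilityMeasure ι] {k l : ℕ} {α : ℕ → ℝ}
    (hα : ∀ i, 0 < α i) {μ ν : S × A → ℝ≥0} (hμ : Measurable μ) (hν : Measurable ν) {K ξ : ℝ}
    (hK : 0 < K) (hξ : 0 < ξ) (hT : HasTests M lam π ι k l α μ ν K ξ) {θ₀ : Θ}
    (htop : ∀ θ, M.dist lam μ θ θ₀ ≠ ∞) {ε : ℕ → ℝ} {t : ℕ} (hε : 0 < ε t)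
    (hent : EntropyBound M lam k l α μ ν (ξ / 2) θ₀ ε t) {P : Measure Θ} [IsFiniteMeasure P]
    {N : ℕ} (hB : P (M.klBall π ι θ₀ t (epsBar k l α ε t) N) ≠ 0) {x x₀ : ℝ}
    (hx : x = t * epsBar k l α ε t ^ 2) (hx₀ : 0 < x₀) (hxx₀ : x₀ ≤ x) {n : ℕ} (hn : 2 ≤ n)
    (hKn : 2 ≤ K * n) (hKx : 8 ≤ K * x₀ * n ^ 2)
    (hprior : ∀ j ≥ n, PriorBound M lam π ι k l α μ K θ₀ ε P N t j) {m : ℝ} (hm : (n : ℝ) ≤ m)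
    {η : ℝ≥0∞} (hη : η ≠ 0) (hηt : η ≠ ∞) :
    M.histLaw π ι θ₀ t {h | η ≤ M.posterior P t h
        {θ | ENNReal.ofReal (m * ε t) < M.dist lam μ θ θ₀}} ≤
      2 * ∑' i : ℕ, ENNReal.ofReal (Real.exp (-(K * x₀ / 4))) ^ (n + i) +
        2 * ENNReal.ofReal (8 / (K * n ^ 2)) +
        4 * (∑' i : ℕ, ENNReal.ofReal (Real.exp (-(K * x₀ / 4))) ^ (n + i)) / η := by
  obtain ⟨q, hq⟩ : ∃ q, q = ENNReal.ofReal (Real.exp (-(K * x₀ / 4))) := ⟨_, rfl⟩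
  obtain ⟨τ, hτ⟩ : ∃ τ, τ = ∑' i : ℕ, q ^ (n + i) := ⟨_, rfl⟩
  rw [← hq, ← hτ]
  obtain ⟨p, hp⟩ : ∃ p, p = P (M.klBall π ι θ₀ t (epsBar k l α ε t) N) := ⟨_, rfl⟩
  rw [← hp] at hB
  have hpt : p ≠ ∞ := hp ▸ measure_ne_top _ _
  obtain ⟨C, hC⟩ : ∃ C, C = {θ | ENNReal.ofReal (m * ε t) < M.dist lam μ θ θ₀} := ⟨_, rfl⟩
  have hCsub := setOf_lt_dist_subset_iUnion_shell M lam μ θ₀ htop hε hm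
  rw [← hC] at hCsub ⊢
  have hx0 : 0 < x := hx₀.trans_le hxx₀
  have hn2 : (2 : ℝ) ≤ n := by exact_mod_cast hn
  -- In shell j ≥ n the tests give −Kxj², the prior ratio costs Kxj²/2 and the evidence costs a ≤
  -- Kxj²/4, so −Kxj²/4 is left. Since a ≥ 2, the evidence fails with probability at most 2x/(a − 1)
  -- ≤ 2 · 8/(Kn²).
  obtain ⟨a, ha⟩ : ∃ a, a = K * x * n ^ 2 / 4 := ⟨_, rfl⟩
  have ha2 : 2 ≤ a := by
    have : K * x₀ * n ^ 2 ≤ K * x * n ^ 2 := by gcongr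
    rw [ha]
    linarith
  -- j² ≥ j and x ≥ x₀ turn the Gaussian-type bounds into a geometric series independent of t.
  have hgeo : ∀ i : ℕ, ∀ y : ℝ, y ≤ -(K * x * ((n + i : ℕ) : ℝ) ^ 2 / 4) →
      ENNReal.ofReal (Real.exp y) ≤ q ^ (n + i) := by
    intro i y hy
    rw [hq, ← ENNReal.ofReal_pow (Real.exp_pos _).le, ← Real.exp_nat_mul]
    refine ENNReal.ofReal_le_ofReal (Real.exp_le_exp.2 (hy.trans ?_))
    have hj1 : (1 : ℝ) ≤ ((n + i : ℕ) : ℝ) := by push_cast; linarith [(i.cast_nonneg : (0:ℝ) ≤ i)]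
    have h1 : K * x₀ ≤ K * x := by gcongr
    have h2 : ((n + i : ℕ) : ℝ) ≤ ((n + i : ℕ) : ℝ) ^ 2 := by nlinarith
    have h3 : K * x₀ * ((n + i : ℕ) : ℝ) ≤ K * x * ((n + i : ℕ) : ℝ) ^ 2 := by gcongr
    linarith
  have htest : ∀ i : ℕ, ∃ φ : Hist S A t → ℝ≥0∞, Measurable φ ∧
      ∫⁻ h, φ h ∂(M.histLaw π ι θ₀ t) ≤ q ^ (n + i) ∧
      ∀ θ ∈ M.shell lam μ θ₀ (ε t) (n + i), ∫⁻ h, (1 - φ h) ∂(M.histLaw π ι θ t) ≤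
        ENNReal.ofReal (Real.exp (-(K * x * ((n + i : ℕ) : ℝ) ^ 2))) := by
    intro i
    obtain ⟨φ, h1, h2, h3⟩ := exists_test_shell hα hν hK hξ hT htop hε hent
      (j := n + i) (by omega) hx
    refine ⟨φ, h1, h2.trans (hgeo i _ ?_), h3⟩
    have hnj : (n : ℝ) ≤ ((n + i : ℕ) : ℝ) := by push_cast; linarith [(i.cast_nonneg : (0:ℝ) ≤ i)]
    have h4 : 2 ≤ K * ((n + i : ℕ) : ℝ) ^ 2 := by
      have : K * n ≤ K * ((n + i : ℕ) : ℝ) := by gcongr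
      nlinarith
    nlinarith
  choose φ hφ hI hII using htest
  obtain ⟨Φ, hΦ⟩ : ∃ Φ : Hist S A t → ℝ≥0∞, Φ = fun h => ⨆ i, φ i h := ⟨_, rfl⟩
  have hΦm : Measurable Φ := hΦ ▸ Measurable.iSup hφ
  have hΦI : ∫⁻ h, Φ h ∂(M.histLaw π ι θ₀ t) ≤ τ := by
    rw [hτ, hΦ]
    calc _ ≤ ∫⁻ h, ∑' i, φ i h ∂(M.histLaw π ι θ₀ t) :=
          lintegral_mono fun h => iSup_le fun i => ENNReal.le_tsum i
      _ = ∑' i, ∫⁻ h, φ i h ∂(M.histLaw π ι θ₀ t) :=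
          lintegral_tsum fun i => (hφ i).aemeasurable
      _ ≤ _ := ENNReal.tsum_le_tsum hI
  have hΦII : ∀ i, ∀ θ ∈ M.shell lam μ θ₀ (ε t) (n + i), ∫⁻ h, (1 - Φ h) ∂(M.histLaw π ι θ t) ≤
      ENNReal.ofReal (Real.exp (-(K * x * ((n + i : ℕ) : ℝ) ^ 2))) := fun i θ hθ =>
    (lintegral_mono fun h => tsub_le_tsub_left
      (by rw [hΦ]; exact le_iSup (fun i => φ i h) i) 1).trans (hII i θ hθ)
  obtain ⟨W, hW⟩ : ∃ W : Hist S A t → ℝ≥0∞, W = fun h =>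
    (1 - Φ h) * ∫⁻ θ in C, M.likelihood t h θ / M.likelihood t h θ₀ ∂P := ⟨_, rfl⟩
  have hWm : Measurable W := hW ▸ (hΦm.const_sub 1).mul
    (measurable_lintegral_likelihood_div M t θ₀ _)
  obtain ⟨c, hc⟩ : ∃ c, c = ENNReal.ofReal (Real.exp a) := ⟨_, rfl⟩
  have hWI : ∫⁻ h, 4 * c / p * W h ∂(M.histLaw π ι θ₀ t) ≤ 4 * τ := by
    rw [lintegral_const_mul _ hWm, hW]
    refine (mul_le_mul' le_rfl (lintegral_likelihood_div_shells_le M lam π ι hμ θ₀ t P hΦm hCsub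
      hΦII)).trans ?_
    rw [← ENNReal.tsum_mul_left, hτ, ← ENNReal.tsum_mul_left]
    refine ENNReal.tsum_le_tsum fun i => ?_
    have hpr : P (M.shell lam μ θ₀ (ε t) (n + i)) / p ≤
        ENNReal.ofReal (Real.exp (K * t * epsBar k l α ε t ^ 2 * ((n + i : ℕ) : ℝ) ^ 2 / 2)) := by
      rw [hp]
      exact hprior (n + i) (by omega)
    calc _ = 4 * (c * (P (M.shell lam μ θ₀ (ε t) (n + i)) / p) *
          ENNReal.ofReal (Real.exp (-(K * x * ((n + i : ℕ) : ℝ) ^ 2)))) := by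
          simp only [div_eq_mul_inv]
          ring
      _ ≤ 4 * (c * ENNReal.ofReal
            (Real.exp (K * t * epsBar k l α ε t ^ 2 * ((n + i : ℕ) : ℝ) ^ 2 / 2)) *
          ENNReal.ofReal (Real.exp (-(K * x * ((n + i : ℕ) : ℝ) ^ 2)))) := by gcongr
      _ ≤ 4 * q ^ (n + i) := by
          refine mul_le_mul' le_rfl ?_
          rw [hc, ← ENNReal.ofReal_mul (Real.exp_pos _).le, ← Real.exp_add,
            ← ENNReal.ofReal_mul (Real.exp_pos _).le, ← Real.exp_add]
          refine hgeo i _ ?_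
          have hnj : (n : ℝ) ≤ ((n + i : ℕ) : ℝ) := by
            push_cast; linarith [(i.cast_nonneg : (0:ℝ) ≤ i)]
          have h1 : K * x * n ^ 2 ≤ K * x * ((n + i : ℕ) : ℝ) ^ 2 := by gcongr
          rw [mul_assoc K, ← hx, ha]
          linarith
  have hevid : M.histLaw π ι θ₀ t {h | c * ∫⁻ θ, M.likelihood t h θ ∂P <
      M.likelihood t h θ₀ * (p / 2)} ≤ 2 * ENNReal.ofReal (8 / (K * n ^ 2)) := by
    rw [hp] at hB ⊢
    rw [hc]
    refine (histLaw_evidence_le M π ι θ₀ t P hB (x := x) (by linarith) fun θ hθ => ?_).trans ?_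
    · rw [hx]
      exact hθ.1
    · refine mul_le_mul' le_rfl (ENNReal.ofReal_le_ofReal ?_)
      rw [div_le_div_iff₀ (by linarith) (by positivity)]
      rw [ha] at ha2 ⊢
      nlinarith
  -- Three ways to fail: the combined test rejects, the evidence is small, or the weighted numerator
  -- is large. The true likelihood is nonzero only almost surely.
  have hcover : ∀ᵐ h ∂(M.histLaw π ι θ₀ t), h ∈ {h | η ≤ M.posterior P t h C} →
      h ∈ ({h | 1 / 2 ≤ Φ h} ∪ {h | c * ∫⁻ θ, M.likelihood t h θ ∂P <
        M.likelihood t h θ₀ * (p / 2)}) ∪ {h | η ≤ 4 * c / p * W h} := by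
    filter_upwards [ae_likelihood_ne_zero M π ι θ₀ t] with h hL hh
    by_contra hnot
    simp only [Set.mem_union, Set.mem_ofPred_eq, not_or, not_le, not_lt] at hnot
    refine hnot.2.not_ge (le_trans hh ?_)
    rw [hW]
    exact posterior_le_of_evidence M t h θ₀ P C hB hpt hL hnot.1.2 hnot.1.1
  refine (measure_mono_ae hcover).trans ((measure_union_le _ _).trans ?_)
  refine add_le_add ((measure_union_le _ _).trans (add_le_add ?_ hevid)) ?_
  · refine (meas_ge_le_lintegral_div hΦm.aemeasurable (by simp) (by simp)).trans ?_
    rw [div_eq_mul_inv, one_div, inv_inv, mul_comm]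
    gcongr
  · exact (meas_ge_le_lintegral_div (hWm.const_mul _).aemeasurable hη hηt).trans
      (ENNReal.div_le_div_right hWI η)

/-! ### Passage to the limit -/

theorem tendsto_tsum_pow_add {q : ℝ≥0∞} (hq : q < 1) :
    Tendsto (fun n : ℕ => ∑' i : ℕ, q ^ (n + i)) atTop (𝓝 0) := by
  have h : ∀ n : ℕ, ∑' i : ℕ, q ^ (n + i) = q ^ n * (1 - q)⁻¹ := fun n => by
    simp only [pow_add]
    rw [ENNReal.tsum_mul_left, ENNReal.tsum_geometric]
  simp only [h]
  have := ENNReal.Tendsto.mul_const (b := (1 - q)⁻¹) (ENNReal.tendsto_pow_atTop_nhds_zero_of_lt_one hq)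
    (Or.inr (ENNReal.inv_ne_top.2 (tsub_pos_of_lt hq).ne'))
  rwa [zero_mul] at this

theorem tendsto_posterior_bound {K x₀ : ℝ} (hK : 0 < K) (hx₀ : 0 < x₀) {η : ℝ≥0∞} (hη : η ≠ 0) :
    Tendsto (fun n : ℕ => 2 * ∑' i : ℕ, ENNReal.ofReal (Real.exp (-(K * x₀ / 4))) ^ (n + i) +
        2 * ENNReal.ofReal (8 / (K * n ^ 2)) +
        4 * (∑' i : ℕ, ENNReal.ofReal (Real.exp (-(K * x₀ / 4))) ^ (n + i)) / η)
      atTop (𝓝 0) := by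
  have hq : ENNReal.ofReal (Real.exp (-(K * x₀ / 4))) < 1 := by
    rw [ENNReal.ofReal_lt_one, Real.exp_lt_one_iff]
    have := mul_pos hK hx₀
    linarith
  have h1 := tendsto_tsum_pow_add hq
  have h2 : Tendsto (fun n : ℕ => ENNReal.ofReal (8 / (K * n ^ 2))) atTop (𝓝 0) := by
    rw [← ENNReal.ofReal_zero]
    refine ENNReal.tendsto_ofReal (Tendsto.div_atTop tendsto_const_nhds ?_)
    exact ((tendsto_pow_atTop two_ne_zero).comp tendsto_natCast_atTop_atTop).const_mul_atTop hK
  have h3 := ((ENNReal.Tendsto.const_mul h1 (Or.inr ENNReal.ofNat_ne_top) (a := 2)).add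
    (ENNReal.Tendsto.const_mul h2 (Or.inr ENNReal.ofNat_ne_top) (a := 2))).add
    (ENNReal.Tendsto.div_const
      (ENNReal.Tendsto.const_mul h1 (Or.inr ENNReal.ofNat_ne_top) (a := 4)) (Or.inr hη))
  simpa using h3

theorem HasTests.mono {M : Model Θ S A} {lam : Measure (S × A)} {π : Policy S A} {ι : Measure S}
    {k l : ℕ} {α : ℕ → ℝ} {μ ν : S × A → ℝ≥0} {K ξ ξ' : ℝ}
    (hT : HasTests M lam π ι k l α μ ν K ξ) (hξ : ξ' ≤ ξ) :
    HasTests M lam π ι k l α μ ν K ξ' := by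
  intro θ₀ θ₁ t
  obtain ⟨φ, h1, h2, h3, h4⟩ := hT θ₀ θ₁ t
  refine ⟨φ, h1, h2, h3, fun θ hθ => h4 θ (hθ.trans ?_)⟩
  gcongr

/-- The posterior contracts at the given rate. -/
theorem tendstoInMeasure_posterior {M : Model Θ S A} {lam : Measure (S × A)} [SFinite lam]
    {π : Policy S A} {ι : Measure S} [IsProbabilityMeasure ι] {k l : ℕ} (hk : 0 < k) {α : ℕ → ℝ}
    (hα : ∀ i, 0 < α i) {μ ν : S × A → ℝ≥0} (hμ : Measurable μ) (hν : Measurable ν) {K ξ : ℝ}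
    (hK : 0 < K) (hξ : 0 < ξ) (hT : HasTests M lam π ι k l α μ ν K ξ) {θ₀ : Θ}
    (htop : ∀ θ, M.dist lam μ θ θ₀ ≠ ∞) {P : ℕ → Measure Θ} (hP : ∀ t, IsProbabilityMeasure (P t))
    {N : ℕ} {ε : ℕ → ℝ} (hε : ∀ t, 0 < ε t)
    (hO : (fun t : ℕ => 1 / (t * epsBar k l α ε t ^ 2)) =O[atTop] (fun _ => (1 : ℝ)))
    (hent : ∀ᶠ t in atTop, EntropyBound M lam k l α μ ν (ξ / 2) θ₀ ε t)
    (hball : ∀ᶠ t in atTop, P t (M.klBall π ι θ₀ t (epsBar k l α ε t) N) ≠ 0)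
    (hprior : ∃ J : ℕ, ∀ᶠ t in atTop, ∀ j ≥ J, PriorBound M lam π ι k l α μ K θ₀ ε (P t) N t j)
    {m : ℕ → ℝ} (hm : Tendsto m atTop atTop) :
    TendstoInMeasure (M.law π ι θ₀)
      (fun t ω => (M.posterior (P t) t (hist t ω)
        {θ | ENNReal.ofReal (m t * ε t) < M.dist lam μ θ θ₀}).toReal) atTop (fun _ => 0) := by
  refine tendstoInMeasure_of_ne_top fun η hη hηt => ?_
  obtain ⟨J, hJ⟩ := hprior
  obtain ⟨c, hc⟩ := hO.bound
  -- The O(1) condition is read as a positive lower bound x₀ on tε̄_t²; adding 1 to |c| makes the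
  -- denominator positive.
  obtain ⟨x₀, hx₀⟩ : ∃ x₀, x₀ = 1 / (|c| + 1) := ⟨_, rfl⟩
  have hx₀pos : 0 < x₀ := by rw [hx₀]; positivity
  have hx : ∀ᶠ t : ℕ in atTop, x₀ ≤ t * epsBar k l α ε t ^ 2 := by
    filter_upwards [hc, eventually_ge_atTop (k + l)] with t ht htkl
    have hpos : 0 < t * epsBar k l α ε t ^ 2 := by
      rw [mul_epsBar_sq hα]
      refine mul_pos (Finset.sum_pos (fun _ _ => hα _) ?_) (pow_pos (hε t) 2)
      rw [Finset.nonempty_range_iff]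
      exact (Nat.div_pos htkl (by omega)).ne'
    rw [norm_one, mul_one, Real.norm_of_nonneg (by positivity), div_le_iff₀ hpos] at ht
    rw [hx₀, div_le_iff₀ (by positivity)]
    nlinarith [le_abs_self c]
  -- The fixed-time bound is used with n = ⌊M_t⌋, so its right side vanishes because M_t → ∞.
  have hfloor : Tendsto (fun t => ⌊m t⌋₊) atTop atTop := tendsto_nat_floor_atTop.comp hm
  have hcast : Tendsto (fun n : ℕ => (n : ℝ)) atTop atTop := tendsto_natCast_atTop_atTop
  have hn1 : ∀ᶠ n : ℕ in atTop, 2 ≤ K * n := (hcast.const_mul_atTop hK).eventually_ge_atTop 2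
  have hn2 : ∀ᶠ n : ℕ in atTop, 8 ≤ K * x₀ * (n : ℝ) ^ 2 :=
    (((tendsto_pow_atTop two_ne_zero).comp hcast).const_mul_atTop
      (mul_pos hK hx₀pos)).eventually_ge_atTop 8
  refine tendsto_of_tendsto_of_tendsto_of_le_of_le' tendsto_const_nhds
    ((tendsto_posterior_bound hK hx₀pos hη.ne').comp hfloor) (Eventually.of_forall fun _ => zero_le) ?_
  filter_upwards [hent, hball, hJ, hx, hm.eventually_ge_atTop 0, hfloor.eventually hn1,
    hfloor.eventually hn2, hfloor.eventually_ge_atTop (max 2 J)] with t h1 h2 h3 h4 h5 h6 h7 h8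
  have := hP t
  refine le_trans ?_ (histLaw_le_posterior_le hα hμ hν hK hξ hT htop (hε t) h1 h2 rfl hx₀pos h4
    (le_trans (le_max_left _ _) h8) h6 h7
    (fun j hj => h3 j ((le_max_right _ _).trans (h8.trans hj))) (Nat.floor_le h5) hη.ne' hηt)
  -- `Measure.le_map_apply` needs no measurability of the event on histories.
  refine le_trans (measure_mono fun ω hω => ?_)
    (Measure.le_map_apply (measurable_hist t).aemeasurable _)
  have hω' := Set.mem_ofPred_eq ▸ hω
  rw [edist_dist, Real.dist_0_eq_abs, abs_of_nonneg ENNReal.toReal_nonneg] at hω'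
  exact hω'.trans ENNReal.ofReal_toReal_le

end MDP

end

theorem mainTheorem1 {Θ S A : Type*} [MeasurableSpace Θ] [MeasurableSpace S] [MeasurableSpace A]
    (M : MDP.Model Θ S A) (lam : Measure (S × A)) [IsFiniteMeasure lam] (π : MDP.Policy S A)
    (k l : ℕ) (hk : 0 < k) (hl : 0 < l) (α : ℕ → ℝ) (hα_pos : ∀ i, 0 < α i) (hα : Antitone α)
    (μ ν : S × A → ℝ≥0) (hμ : Measurable μ) (hν : Measurable ν) :
    ∃ K > (0 : ℝ), ∃ ξ ∈ Set.Ioo (0 : ℝ) 1,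
      ∀ ι : Measure S, IsProbabilityMeasure ι → MDP.UniformBounds M lam π ι k l α μ ν →
        MDP.HasTests M lam π ι k l α μ ν K ξ ∧
        ∀ (θ₀ : Θ) (P : ℕ → Measure Θ) (n : ℕ) (ε : ℕ → ℝ),
          (∀ t, IsProbabilityMeasure (P t)) →
          (∀ t, 0 < ε t) →
          Tendsto ε atTop (𝓝 0) →
          (fun t : ℕ => 1 / (t * MDP.epsBar k l α ε t ^ 2)) =O[atTop] (fun _ => (1 : ℝ)) →
          (∀ᶠ t in atTop, MDP.EntropyBound M lam k l α μ ν ξ θ₀ ε t) →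
          (∀ᶠ t in atTop, P t (M.klBall π ι θ₀ t (MDP.epsBar k l α ε t) n) ≠ 0) →
          (∃ J : ℕ, ∀ᶠ t in atTop, ∀ j ≥ J,
            MDP.PriorBound M lam π ι k l α μ K θ₀ ε (P t) n t j) →
          ∀ m : ℕ → ℝ, Tendsto m atTop atTop →
            TendstoInMeasure (M.law π ι θ₀)
              (fun t ω => (M.posterior (P t) t (MDP.hist t ω)
                {θ | ENNReal.ofReal (m t * ε t) < M.dist lam μ θ θ₀}).toReal)
              atTop (fun _ => 0) := by
  -- The tests hold with ξ = 1/48; half of it is announced, which pays for the recentring of the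
  -- covering balls.
  refine ⟨1 / 512, by norm_num, 1 / 48 / 2, ⟨by norm_num, by norm_num⟩, fun ι hι hU => ?_⟩
  have hT := MDP.hasTests M lam π ι hk hl hα_pos hα hμ hν hU
  refine ⟨hT.mono (by norm_num), fun θ₀ P n ε hP hε _ hO hent hball hprior m hm => ?_⟩
  exact MDP.tendstoInMeasure_posterior hk hα_pos hμ hν (by norm_num) (by norm_num) hT
    (fun θ => MDP.dist_ne_top M lam π ι hα_pos hμ hU θ θ₀) hP hε hO hent hball hprior hm
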